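/- Let $F$ be a field. A width-$2$ ROABP over $F$ in the variables $\overline{x}=(x_1,\dots,x_n)$ is an expression $$C(\overline{x}) = D_0^{T}(\overline{x}_0)\Big(\prod_{i=1}^{d} D_i(\overline{x}_i)\Big) D_{d+1}(\overline{x}_{d+1}),$$ where $d\ge 0$, $\overline{x}=\overline{x}_0\sqcup\dots\sqcup\overline{x}_{d+1}$ is any partition of the variables (parts may be empty), $D_0\in F[\overline{x}_0]^2$, $D_{d+1}\in F[\overline{x}_{d+1}]^2$, and $D_i\in F[\overline{x}_i]^{2\times 2}$ for $1\le i\le d$; no invertibility is required. For natural numbers $n,\delta,s,\mu$ let $\mathcal{C}_F(n,\delta,s,\mu)$ be the set of all polynomials $C\in F[\overline{x}]$ computed by such ROABPs, with arbitrary $d$ and arbitrary partition, in which every factor $D_i$, $0\le i\le d+1$, viewed as one polynomial with vector or matrix coefficients, has degree at most $\delta$ in each variable (for instance, total degree at most $\delta$), at most $s$ monomials with nonzero coefficient, and at most $\mu$ variables in each of its monomials. Put $$\ell := 1+2\min\{\lceil\log_2(4s)\rceil,\mu\}$$ (with $\lceil \log_2 0\rceil$ read as $0$). **Theorem.** The class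 $\mathcal{C}_F(n,\delta,s,\mu)$ has a hitting-set of size $\operatorname{poly}((n\delta s)^{\ell})$, and it can be computed in that time. Precisely, there are a polynomial $p$ with natural-number coefficients and one program $P$ for an algebraic random access machine, neither depending on any of the parameters or fields, such that the following holds for all $n,\delta,s,\mu$, all fields $F$, all extension fields $K\supseteq F$ (such as $K=F$) and all sequences $\beta_0,\beta_1,\dots$ in $K$ whose first $p((n\delta s)^{\ell})$ terms are distinct. On input $(n,\delta,s,\mu)$ and with access to the sequence $\beta$, the program $P$ halts after at most $p\big(n+(n\delta s)^{\ell}\big)$ steps and outputs a list $H$ of at most $p((n\delta s)^{\ell})$ points of $K^n$ such that for every nonzero $C\in\mathcal{C}_F(n,\delta,s,\mu)$ there is $\overline{a}\in H$ with $C(\overline{a})\ne 0$. (If $\delta,s\ge 1$ then $n\le (n\delta s)^{\ell}$, so the time bound is $\operatorname{poly}((n\delta s)^{\ell})$; the summand $n$ only matters for degenerate parameters, where writing down one point already takes $n$ steps.) The machine has a memory of natural numbers and a memory of elements of $K$, both with indirect addressing, and an output tape of elements of $K$. Integer additions, truncated subtractions, memory accesses, tests of an integer for zero, output instructions, field operations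 and calls of $\beta_i$ cost one step each; integer multiplications and divisions cost in addition the bit lengths of their operands. Programs do not test field elements. -/

import Mathlib

/-! ### Read-once algebraic branching programs -/

namespace ROABP

/-- The set of monomials with a nonzero coefficient in a finite array `D` of polynomials, regarded
as one polynomial with vector (or matrix) coefficients. Its cardinality is the sparsity of `D`. -/
def monomials {F ι : Type*} [Field F] [Fintype ι] {n : ℕ}
    (D : ι → MvPolynomial (Fin n) F) : Finset (Fin n →₀ ℕ) :=
  Finset.univ.biUnion fun i => (D i).support

/-- `D` involves only the variables in the set `X`. -/
def UsesOnly {F ι : Type*} [Field F] [Fintype ι] {n : ℕ}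
    (D : ι → MvPolynomial (Fin n) F) (X : Set (Fin n)) : Prop :=
  ∀ e ∈ monomials D, ∀ j : Fin n, e j ≠ 0 → j ∈ X

/-- `D` has degree at most `δ` in each variable, at most `s` monomials, and each of its monomials
involves at most `μ` variables. -/
structure Bounded {F ι : Type*} [Field F] [Fintype ι] {n : ℕ}
    (δ s μ : ℕ) (D : ι → MvPolynomial (Fin n) F) : Prop where
  degree_le : ∀ e ∈ monomials D, ∀ j : Fin n, e j ≤ δ
  sparsity_le : (monomials D).card ≤ s
  support_le : ∀ e ∈ monomials D, e.support.card ≤ μ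

/-- The entries of a matrix as an array. -/
def entries {R : Type*} {w : ℕ} (M : Matrix (Fin w) (Fin w) R) : Fin w × Fin w → R :=
  fun p => M p.1 p.2

end ROABP

/-- A width-`w` read-once ABP over `F` in `n` variables, in matrix form: a row vector, `d` square
matrices and a column vector, whose entries are polynomials in disjoint sets of variables.
`block j` is the index of the factor that may contain the `j`-th variable. -/
structure ROABP (F : Type*) [Field F] (n w : ℕ) where
  d : ℕ
  block : Fin n → Fin (d + 2)
  first : Fin w → MvPolynomial (Fin n) F
  middle : Fin d → Matrix (Fin w) (Fin w) (MvPolynomial (Fin n) F)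
  last : Fin w → MvPolynomial (Fin n) F
  first_vars : ROABP.UsesOnly first {j | block j = 0}
  middle_vars : ∀ i : Fin d, ROABP.UsesOnly (ROABP.entries (middle i)) {j | block j = i.succ.castSucc}
  last_vars : ROABP.UsesOnly last {j | block j = Fin.last (d + 1)}

namespace ROABP

variable {F : Type*} [Field F] {n w : ℕ}

/-- The polynomial `D₀ᵀ (D₁ ⋯ D_d) D_{d+1}` computed by an ROABP. -/
noncomputable def poly (A : ROABP F n w) : MvPolynomial (Fin n) F :=
  A.first ⬝ᵥ ((List.ofFn A.middle).prod.mulVec A.last)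

/-- All factors of the ROABP, including the first and the last one, obey the bounds. -/
structure FactorsBounded (A : ROABP F n w) (δ s μ : ℕ) : Prop where
  first : Bounded δ s μ A.first
  middle : ∀ i : Fin A.d, Bounded δ s μ (entries (A.middle i))
  last : Bounded δ s μ A.last

end ROABP

/-- The polynomials over `F` computed by width-`w` ROABPs in `n` variables with an arbitrary number
of factors, an arbitrary partition of the variables, and all factors bounded by `δ, s, μ`. -/
def roabpClass (F : Type*) [Field F] (n w δ s μ : ℕ) : Set (MvPolynomial (Fin n) F) :=
  {C | ∃ A : ROABP F n w, A.FactorsBounded δ s μ ∧ A.poly = C}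

/-- A list of points of `Kⁿ` is a hitting-set for a class of polynomials over `F ⊆ K` if every
nonzero polynomial of the class is nonzero at some point of the list. -/
def IsHittingSet {F K : Type*} [Field F] [Field K] [Algebra F K] {n : ℕ}
    (H : List (Fin n → K)) (𝒞 : Set (MvPolynomial (Fin n) F)) : Prop :=
  ∀ C ∈ 𝒞, C ≠ 0 → ∃ a ∈ H, MvPolynomial.aeval a C ≠ 0

/-! ### An algebraic random access machine

Programs work on a memory of natural numbers, a memory of elements of a field `K`, and an output
tape of field elements. They are written without reference to `K`; besides `0` and `1`, field
elements come from an enumeration `β 0, β 1, …` of elements of `K` that the machine can consult. -/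

namespace AlgRAM

/-- Integer expressions; `load` reads the integer memory (indirect addressing). -/
inductive IExp : Type
  | const (k : ℕ)
  | load (addr : IExp)
  | add (a b : IExp)
  | sub (a b : IExp)
  | mul (a b : IExp)
  | div (a b : IExp)

/-- Field expressions; `load` reads the field memory and `elt i` is the enumerated element `β i`. -/
inductive FExp : Type
  | zero
  | one
  | load (addr : IExp)
  | elt (i : IExp)
  | add (a b : FExp)
  | sub (a b : FExp)
  | mul (a b : FExp)
  | inv (a : FExp)

/-- Programs. Tests are integer expressions, and a nonzero value counts as true. -/
inductive Prog : Type
  | skip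
  | istore (addr val : IExp)
  | fstore (addr : IExp) (val : FExp)
  | write (val : FExp)
  | seq (P Q : Prog)
  | ite (c : IExp) (P Q : Prog)
  | while (c : IExp) (P : Prog)

/-- Configurations of the memory. -/
structure Store (K : Type*) where
  imem : ℕ → ℕ
  fmem : ℕ → K
  out : List K

/-- Value of an integer expression (truncated subtraction, integer division). -/
def IExp.val (m : ℕ → ℕ) : IExp → ℕ
  | .const k => k
  | .load a => m (a.val m)
  | .add a b => a.val m + b.val m
  | .sub a b => a.val m - b.val m
  | .mul a b => a.val m * b.val m
  | .div a b => a.val m / b.val m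

/-- Time to evaluate an integer expression: one step per operation, and for multiplications and
divisions also the bit lengths of the two operands. -/
def IExp.time (m : ℕ → ℕ) : IExp → ℕ
  | .const _ => 1
  | .load a => a.time m + 1
  | .add a b => a.time m + b.time m + 1
  | .sub a b => a.time m + b.time m + 1
  | .mul a b => a.time m + b.time m + (a.val m).size + (b.val m).size + 1
  | .div a b => a.time m + b.time m + (a.val m).size + (b.val m).size + 1

/-- Value of a field expression. -/
def FExp.val {K : Type*} [Field K] (β : ℕ → K) (σ : Store K) : FExp → K
  | .zero => 0
  | .one => 1
  | .load a => σ.fmem (a.val σ.imem)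
  | .elt i => β (i.val σ.imem)
  | .add a b => a.val β σ + b.val β σ
  | .sub a b => a.val β σ - b.val β σ
  | .mul a b => a.val β σ * b.val β σ
  | .inv a => (a.val β σ)⁻¹

/-- Time to evaluate a field expression: one step per field operation, plus address computations. -/
def FExp.time (m : ℕ → ℕ) : FExp → ℕ
  | .zero => 1
  | .one => 1
  | .load a => a.time m + 1
  | .elt i => i.time m + 1
  | .add a b => a.time m + b.time m + 1
  | .sub a b => a.time m + b.time m + 1
  | .mul a b => a.time m + b.time m + 1
  | .inv a => a.time m + 1

/-- `Exec β P σ σ' t`: started in `σ`, the program `P` halts in `σ'` after `t` steps. -/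
inductive Exec {K : Type*} [Field K] (β : ℕ → K) : Prog → Store K → Store K → ℕ → Prop
  | skip (σ : Store K) : Exec β .skip σ σ 1
  | istore (σ : Store K) (a v : IExp) :
      Exec β (.istore a v) σ
        { σ with imem := Function.update σ.imem (a.val σ.imem) (v.val σ.imem) }
        (a.time σ.imem + v.time σ.imem + 1)
  | fstore (σ : Store K) (a : IExp) (v : FExp) :
      Exec β (.fstore a v) σ
        { σ with fmem := Function.update σ.fmem (a.val σ.imem) (v.val β σ) }
        (a.time σ.imem + v.time σ.imem + 1)
  | write (σ : Store K) (v : FExp) :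
      Exec β (.write v) σ { σ with out := σ.out ++ [v.val β σ] } (v.time σ.imem + 1)
  | seq {P Q : Prog} {σ σ' σ'' : Store K} {t t' : ℕ} :
      Exec β P σ σ' t → Exec β Q σ' σ'' t' → Exec β (.seq P Q) σ σ'' (t + t' + 1)
  | ite_true {c : IExp} {P Q : Prog} {σ σ' : Store K} {t : ℕ} :
      c.val σ.imem ≠ 0 → Exec β P σ σ' t → Exec β (.ite c P Q) σ σ' (c.time σ.imem + t + 1)
  | ite_false {c : IExp} {P Q : Prog} {σ σ' : Store K} {t : ℕ} :
      c.val σ.imem = 0 → Exec β Q σ σ' t → Exec β (.ite c P Q) σ σ' (c.time σ.imem + t + 1)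
  | while_true {c : IExp} {P : Prog} {σ σ' σ'' : Store K} {t t' : ℕ} :
      c.val σ.imem ≠ 0 → Exec β P σ σ' t → Exec β (.while c P) σ' σ'' t' →
        Exec β (.while c P) σ σ'' (c.time σ.imem + t + t' + 1)
  | while_false {c : IExp} {P : Prog} {σ : Store K} :
      c.val σ.imem = 0 → Exec β (.while c P) σ σ (c.time σ.imem + 1)

/-- Initial configuration: the input is in the first cells of the integer memory, every other cell
is zero, and the output tape is empty. -/
def init (K : Type*) [Field K] (input : List ℕ) : Store K where
  imem := fun i => input.getD i 0
  fmem := fun _ => 0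
  out := []

/-- On the given input, `P` halts after `t` steps and has written exactly the points of the list
`H`, each as its `n` coordinates in order. -/
def Outputs {K : Type*} [Field K] (β : ℕ → K) (P : Prog) (input : List ℕ) {n : ℕ}
    (H : List (Fin n → K)) (t : ℕ) : Prop :=
  ∃ σ : Store K, Exec β P (init K input) σ t ∧ σ.out = (H.map List.ofFn).flatten

end AlgRAM

/-! Put `k = min(⌈log₂(4s)⌉, μ)`. The hitting-set consists of values of a generator with `5k` pairs
of parameters. One pair adds a multiple of a Lagrange basis polynomial, evaluated at a movable node,
to the all-ones vector, so it can change any single coordinate arbitrarily. Hence `r` further pairs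
reach every point within Hamming distance `r` of a point already generated (`exists_genPoint_add`).

Sparse polynomials need few changes: near any point `a` with nonzero coordinates, a nonzero
polynomial with at most `s` monomials in at most `μ` variables each has a nonzero within distance
`min(log₂ s, μ)` (`exists_eval_ne_zero_near`). Setting a variable to its value in `a` either keeps
the polynomial nonzero, or every surviving monomial pattern had two preimages, so that leaving `a`
there halves the sparsity.

Width two enters twice. If an interior factor is singular over the polynomial ring, a nonzero entry
of it times the product is a product of two shorter ROABPs (`mul_entry_eq_of_det_eq_zero`). If all
interior determinants are nonzero polynomials, `2k` pairs generate a point `a` where they are all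
nonzero and all coordinates of `a` are nonzero. Then, starting from a point where the ROABP does not
vanish, all factors except the two ends and at most one interior one can be evaluated at `a` instead
(`exists_single_replacement`). Within these three blocks the sparse argument returns to `a` up to
`3k` coordinates, and `2k + 3k = 5k`.

Composed with the generator, the ROABP is a polynomial of degree at most `n²δ` in each of `10k`
parameters, so a grid of `(n²δ + 1)^(10k)` parameter values suffices. The program enumerates the
grid by the digits of a counter in base `n²δ + 1`. -/

namespace ROABP

/-! ### Nonzeros of sparse polynomials near a given point. -/

section Sparse

open MvPolynomial

/-- Substitution of the constant `c` for the first variable. -/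
noncomputable def fixFirst {L : Type*} [Field L] {n : ℕ} (c : L)
    (p : MvPolynomial (Fin (n + 1)) L) : MvPolynomial (Fin n) L :=
  (finSuccEquiv L n p).eval (C c)

theorem eval_fixFirst {L : Type*} [Field L] {n : ℕ} (c : L) (p : MvPolynomial (Fin (n + 1)) L)
    (z : Fin n → L) : eval z (fixFirst c p) = eval (Fin.cons c z : Fin (n + 1) → L) p := by
  rw [eval_eq_eval_mv_eval', Polynomial.eval_map, fixFirst, ← Polynomial.eval₂_at_apply, eval_C]

theorem coeff_fixFirst {L : Type*} [Field L] {n : ℕ} (c : L) (p : MvPolynomial (Fin (n + 1)) L)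
    (m : Fin n →₀ ℕ) : coeff m (fixFirst c p) =
      ∑ i ∈ Finset.range ((finSuccEquiv L n p).natDegree + 1), coeff (m.cons i) p * c ^ i := by
  rw [fixFirst, Polynomial.eval_eq_sum_range, coeff_sum]
  refine Finset.sum_congr rfl fun i _ => ?_
  rw [← C_pow, mul_comm, coeff_C_mul, finSuccEquiv_coeff_coeff, mul_comm]

theorem exists_cons_mem_support {L : Type*} [Field L] {n : ℕ} {c : L}
    {p : MvPolynomial (Fin (n + 1)) L} {m : Fin n →₀ ℕ} (hm : m ∈ (fixFirst c p).support) :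
    ∃ i, m.cons i ∈ p.support := by
  rw [mem_support_iff, coeff_fixFirst] at hm
  obtain ⟨i, -, hi⟩ := Finset.exists_ne_zero_of_sum_ne_zero hm
  exact ⟨i, mem_support_iff.2 (left_ne_zero_of_mul hi)⟩

/-- The coefficient of `m` after the substitution is `∑ᵢ coeff (m.cons i) p * a ^ i`; a single
nonzero term could not cancel because `a ≠ 0`. -/
theorem exists_cons_mem_support_ne {L : Type*} [Field L] {n : ℕ} {a : L} (ha : a ≠ 0)
    {p : MvPolynomial (Fin (n + 1)) L} (hp : fixFirst a p = 0) {m : Fin n →₀ ℕ} {i : ℕ}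
    (hi : m.cons i ∈ p.support) : ∃ i', i' ≠ i ∧ m.cons i' ∈ p.support := by
  by_contra! h
  have hz : coeff m (fixFirst a p) = 0 := by rw [hp, coeff_zero]
  rw [coeff_fixFirst, Finset.sum_eq_single i] at hz
  · exact (mem_support_iff.1 hi) ((mul_eq_zero.1 hz).resolve_right (pow_ne_zero _ ha))
  · intro j _ hj
    rw [notMem_support_iff.1 (h j hj), zero_mul]
  · intro hnot
    exfalso
    rw [mem_support_iff, ← finSuccEquiv_coeff_coeff] at hi
    apply hi
    rw [Polynomial.coeff_eq_zero_of_natDegree_lt, coeff_zero]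
    · exact Nat.lt_of_succ_le (not_lt.1 fun h => hnot (Finset.mem_range.2 h))

theorem card_support_cons {n : ℕ} (m : Fin n →₀ ℕ) (i : ℕ) :
    (m.cons i).support.card = m.support.card + if i = 0 then 0 else 1 := by
  have h : ∀ {k : ℕ} (e : Fin k →₀ ℕ), e.support.card = ∑ j, if e j ≠ 0 then 1 else 0 := by
    intro k e
    rw [show e.support = Finset.univ.filter fun j => e j ≠ 0 by ext; simp, Finset.card_filter]
  rw [h, h, Fin.sum_univ_succ, add_comm]
  refine congrArg₂ (· + ·) (Finset.sum_congr rfl fun j _ => by rw [Finsupp.cons_succ]) ?_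
  by_cases hi : i = 0 <;> simp [hi]

theorem hammingDist_cons {L : Type*} [DecidableEq L] {n : ℕ} (c : L) (z : Fin n → L)
    (a : Fin (n + 1) → L) : hammingDist (Fin.cons c z : Fin (n + 1) → L) a =
      hammingDist z (Fin.tail a) + if c = a 0 then 0 else 1 := by
  have h : ∀ {k : ℕ} (x y : Fin k → L), hammingDist x y = ∑ j, if x j ≠ y j then 1 else 0 :=
    fun x y => Finset.card_filter _ _
  rw [h, h, Fin.sum_univ_succ, add_comm]
  refine congrArg₂ (· + ·) (Finset.sum_congr rfl fun j _ => rfl) ?_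
  by_cases hc : c = a 0 <;> simp [hc]

theorem support_fixFirst_subset {L : Type*} [Field L] {n : ℕ} (c : L)
    (p : MvPolynomial (Fin (n + 1)) L) :
    (fixFirst c p).support ⊆ p.support.image Finsupp.tail := fun m hm => by
  obtain ⟨i, hi⟩ := exists_cons_mem_support hm
  exact Finset.mem_image.2 ⟨_, hi, Finsupp.tail_cons i m⟩

/-- Every nonempty fibre of `Finsupp.tail` on the support of `p` has two elements, so any other
value of the first variable leaves at most half of the monomials. -/
theorem two_mul_card_support_fixFirst_le {L : Type*} [Field L] {n : ℕ} {a : L} (ha : a ≠ 0)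
    {p : MvPolynomial (Fin (n + 1)) L} (hp : fixFirst a p = 0) (c : L) :
    2 * (fixFirst c p).support.card ≤ p.support.card := by
  refine (Nat.mul_le_mul_left 2 (Finset.card_le_card (support_fixFirst_subset c p))).trans
    (Finset.mul_card_image_le_card _ _ fun m hm => ?_)
  obtain ⟨d, hd, rfl⟩ := Finset.mem_image.1 hm
  rw [← Finsupp.cons_tail d] at hd
  obtain ⟨i', hne, hi'⟩ := exists_cons_mem_support_ne ha hp hd
  refine Finset.one_lt_card.2 ⟨d, ?_, (d.tail).cons i', ?_, ?_⟩
  · rw [Finsupp.cons_tail] at hd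
    exact Finset.mem_filter.2 ⟨hd, rfl⟩
  · exact Finset.mem_filter.2 ⟨hi', Finsupp.tail_cons _ _⟩
  · intro h
    exact hne (by rw [h, Finsupp.cons_zero])

/-- A nonzero polynomial is nonzero at a point that differs from a given point `a` with nonzero
coordinates in at most logarithmically many coordinates, and in at most as many coordinates as
some monomial has variables. -/
theorem exists_eval_ne_zero_near {L : Type*} [Field L] [Infinite L] [DecidableEq L] {n : ℕ}
    (p : MvPolynomial (Fin n) L) (a : Fin n → L) (ha : ∀ j, a j ≠ 0) (hp : p ≠ 0) :
    ∃ z : Fin n → L, eval z p ≠ 0 ∧ 2 ^ hammingDist z a ≤ p.support.card ∧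
      ∃ e ∈ p.support, hammingDist z a ≤ e.support.card := by
  induction n with
  | zero =>
    have hs : p.support.Nonempty := support_nonempty.2 hp
    refine ⟨a, fun h => hp (MvPolynomial.funext fun x => ?_), ?_, ?_⟩
    · rw [Subsingleton.elim x a, h, map_zero]
    · simpa using hs.card_pos
    · obtain ⟨e, he⟩ := hs
      exact ⟨e, he, by simp⟩
  | succ n ih =>
    -- If the value `a 0` kills `p`, another value is taken: this costs one unit of distance and
    -- halves the support. Otherwise `a 0` is kept at no cost.
    by_cases h0 : fixFirst (a 0) p = 0
    · obtain ⟨x, hx⟩ : ∃ x, eval x p ≠ 0 := by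
        by_contra! h
        exact hp (MvPolynomial.funext fun x => by rw [h, map_zero])
      have hq : fixFirst (x 0) p ≠ 0 := by
        intro h
        apply hx
        rw [← Fin.cons_self_tail x, ← eval_fixFirst, h, map_zero]
      obtain ⟨z, hz, hc, e, he, hec⟩ := ih _ (Fin.tail a) (fun j => ha j.succ) hq
      have hle := hammingDist_cons (x 0) z a
      have hle' : (if x 0 = a 0 then 0 else 1) ≤ 1 := by split_ifs <;> omega
      refine ⟨Fin.cons (x 0) z, by rwa [← eval_fixFirst], ?_, ?_⟩
      · have h2 := two_mul_card_support_fixFirst_le (ha 0) h0 (x 0)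
        calc _ ≤ 2 ^ (hammingDist z (Fin.tail a) + 1) :=
              Nat.pow_le_pow_right two_pos (by omega)
          _ ≤ _ := by rw [pow_succ]; omega
      · obtain ⟨i, hi⟩ := exists_cons_mem_support he
        -- Of two monomials over the same tail, at least one contains the first variable; it pays
        -- for the extra unit of distance.
        obtain ⟨i', hne, hi'⟩ := exists_cons_mem_support_ne (ha 0) h0 hi
        by_cases hi0 : i = 0
        · refine ⟨_, hi', ?_⟩
          rw [card_support_cons, if_neg (by omega)]
          omega
        · refine ⟨_, hi, ?_⟩
          rw [card_support_cons, if_neg hi0]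
          omega
    · obtain ⟨z, hz, hc, e, he, hec⟩ := ih _ (Fin.tail a) (fun j => ha j.succ) h0
      have hle := hammingDist_cons (a 0) z a
      rw [if_pos rfl, add_zero] at hle
      refine ⟨Fin.cons (a 0) z, by rwa [← eval_fixFirst], ?_, ?_⟩
      · rw [hle]
        exact hc.trans ((Finset.card_le_card (support_fixFirst_subset _ _)).trans
          Finset.card_image_le)
      · obtain ⟨i, hi⟩ := exists_cons_mem_support he
        refine ⟨_, hi, ?_⟩
        rw [hle, card_support_cons]
        omega

end Sparse

/-! ### Lagrange-type deviations. -/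

section Generator

/-- The deviation from a base point: `∑ᵢ v₂ᵢ ∏ (v₂ᵢ₊₁ - β_{i'})` over `i' ≠ j`, a sum of
unnormalized Lagrange basis polynomials. -/
def deviation {R : Type*} [CommRing R] (β : ℕ → R) (n q : ℕ) (v : ℕ → R) (j : ℕ) : R :=
  ∑ i ∈ Finset.range q, v (2 * i) * ∏ i' ∈ (Finset.range n).erase j, (v (2 * i + 1) - β i')

theorem map_deviation {R S : Type*} [CommRing R] [CommRing S] (f : R →+* S) (β : ℕ → R) (n q : ℕ)
    (v : ℕ → R) (j : ℕ) :
    f (deviation β n q v j) = deviation (fun i => f (β i)) n q (fun i => f (v i)) j := by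
  simp [deviation, map_sum, map_prod]

theorem deviation_congr {R : Type*} [CommRing R] (β : ℕ → R) (n q : ℕ) {v w : ℕ → R}
    (h : ∀ i < 2 * q, v i = w i) (j : ℕ) : deviation β n q v j = deviation β n q w j := by
  refine Finset.sum_congr rfl fun i hi => ?_
  have := Finset.mem_range.1 hi
  rw [h _ (by omega), h _ (by omega)]

theorem deviation_zero {R : Type*} [CommRing R] (β : ℕ → R) (n q : ℕ) (j : ℕ) :
    deviation β n q (fun _ => 0) j = 0 := by
  simp [deviation]

theorem deviation_add {R : Type*} [CommRing R] (β : ℕ → R) (n q r : ℕ) (v : ℕ → R) (j : ℕ) :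
    deviation β n (q + r) v j =
      deviation β n q v j + deviation β n r (fun i => v (2 * q + i)) j := by
  simp only [deviation, Finset.sum_range_add, mul_add, add_assoc]

/-- Concatenating parameter lists adds deviations, so budgets of changed coordinates add up. -/
theorem deviation_append {R : Type*} [CommRing R] (β : ℕ → R) (n q r : ℕ) (v w : ℕ → R) (j : ℕ) :
    deviation β n (q + r) (fun i => if i < 2 * q then v i else w (i - 2 * q)) j =
      deviation β n q v j + deviation β n r w j := by
  rw [deviation_add]
  congr 1
  · exact deviation_congr _ _ _ (fun i hi => if_pos hi) _
  · exact deviation_congr _ _ _ (fun i _ => by simp) _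

theorem deviation_one {R : Type*} [CommRing R] (β : ℕ → R) (n : ℕ) (v : ℕ → R) (j : ℕ) :
    deviation β n 1 v j = v 0 * ∏ i' ∈ (Finset.range n).erase j, (v 1 - β i') := by
  simp [deviation]

/-- Every vector with at most `q` nonzero coordinates is a deviation. -/
theorem exists_deviation_eq {L : Type*} [Field L] [DecidableEq L] {β : ℕ → L} {n : ℕ}
    (hβ : Set.InjOn β (Set.Iio n)) : ∀ (q : ℕ) (d : Fin n → L),
    (Finset.univ.filter fun j => d j ≠ 0).card ≤ q → ∃ v : ℕ → L, ∀ j : Fin n,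
      deviation β n q v j = d j := by
  intro q
  induction q with
  | zero =>
    intro d hd
    refine ⟨0, fun j => ?_⟩
    have : j ∉ Finset.univ.filter fun j => d j ≠ 0 := by
      rw [Finset.card_eq_zero.1 (Nat.le_zero.1 hd)]; simp
    simp only [Finset.mem_filter, Finset.mem_univ, true_and, not_not] at this
    simp [deviation, this]
  | succ q ih =>
    intro d hd
    by_cases h : ∃ j₀, d j₀ ≠ 0
    · obtain ⟨j₀, hj₀⟩ := h
      obtain ⟨v, hv⟩ := ih (Function.update d j₀ 0) (by
        have hsub : (Finset.univ.filter fun j => Function.update d j₀ 0 j ≠ 0) ⊆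
            (Finset.univ.filter fun j => d j ≠ 0).erase j₀ := by
          intro j hj
          simp only [Finset.mem_filter, Finset.mem_univ, true_and] at hj
          have hne : j ≠ j₀ := by
            rintro rfl
            simp at hj
          rw [Function.update_of_ne hne] at hj
          simp [hne, hj]
        have := Finset.card_le_card hsub
        rw [Finset.card_erase_of_mem (by simpa using hj₀)] at this
        omega)
      -- `N` is the unnormalized basis polynomial of `j₀` at its own node. The pair `(d j₀ / N, β
      -- j₀)` therefore yields `d j₀` at `j₀`, and zero elsewhere because the factor with `i' = j₀`
      -- vanishes.
      set N : L := ∏ i' ∈ (Finset.range n).erase j₀, (β j₀ - β i') with hN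
      have hN0 : N ≠ 0 := by
        refine Finset.prod_ne_zero_iff.2 fun i hi => sub_ne_zero.2 fun h => ?_
        have hi' := Finset.mem_erase.1 hi
        exact hi'.1 (hβ (Finset.mem_range.1 hi'.2) j₀.2 h.symm)
      refine ⟨_, fun j => (deviation_append β n q 1 v
        (fun i => if i = 0 then d j₀ / N else β j₀) j).trans ?_⟩
      rw [hv, deviation_one]
      by_cases hj : j = j₀
      · subst hj
        simp only [Function.update_self, if_true, one_ne_zero, if_false, ← hN, zero_add]
        exact div_mul_cancel₀ _ hN0
      · rw [Function.update_of_ne hj, Finset.prod_eq_zero (i := (j₀ : ℕ)), mul_zero, add_zero]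
        · simpa using fun h => hj (Fin.ext h.symm)
        · simp
    · push Not at h
      exact ⟨fun _ => 0, fun j => by rw [deviation_zero, h]⟩

end Generator

end ROABP

namespace ROABP

/-! ### Polynomials hit by the generator. -/

section Hit

open MvPolynomial

/-- The point of the generator with parameters `v`. -/
def genPoint {R : Type*} [CommRing R] (β : ℕ → R) (n q : ℕ) (v : ℕ → R) (j : Fin n) : R :=
  1 + deviation β n q v j

/-- The generator hits `f`. -/
def Hit {L : Type*} [Field L] {n : ℕ} (β : ℕ → L) (q : ℕ) (f : MvPolynomial (Fin n) L) : Prop :=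
  ∃ v : ℕ → L, eval (genPoint β n q v) f ≠ 0

/-- Extension of a finite family by zero. -/
def extendZero {R : Type*} [Zero R] {m : ℕ} (x : Fin m → R) (i : ℕ) : R :=
  if h : i < m then x ⟨i, h⟩ else 0

/-- The generator as a tuple of polynomials. -/
noncomputable def genPoly {L : Type*} [Field L] (β : ℕ → L) (n q : ℕ) (j : Fin n) :
    MvPolynomial (Fin (2 * q)) L :=
  genPoint (fun i => C (β i)) n q (extendZero X) j

theorem eval_genPoly {L : Type*} [Field L] (β : ℕ → L) (n q : ℕ) (j : Fin n)
    (x : Fin (2 * q) → L) :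
    eval x (genPoly β n q j) = genPoint β n q (extendZero x) j := by
  rw [genPoly, genPoint, genPoint, map_add, map_one, map_deviation]
  congr 2
  · ext; simp
  · ext i
    unfold extendZero
    split_ifs <;> simp

theorem eval_bind₁_genPoly {L : Type*} [Field L] {n : ℕ} (β : ℕ → L) (q : ℕ)
    (f : MvPolynomial (Fin n) L) (x : Fin (2 * q) → L) :
    eval x (bind₁ (genPoly β n q) f) = eval (genPoint β n q (extendZero x)) f := by
  rw [← coe_aeval_eq_eval, ← coe_aeval_eq_eval, RingHom.coe_coe, RingHom.coe_coe, aeval_bind₁]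
  congr 2
  ext j
  rw [← eval_genPoly, ← coe_aeval_eq_eval, RingHom.coe_coe]

/-- Over an infinite field being hit means having nonzero image in a polynomial ring. Since that
ring is a domain, one choice of parameters serves several polynomials at once. -/
theorem hit_iff_bind₁_ne_zero {L : Type*} [Field L] [Infinite L] {n : ℕ} {β : ℕ → L} {q : ℕ}
    {f : MvPolynomial (Fin n) L} : Hit β q f ↔ bind₁ (genPoly β n q) f ≠ 0 := by
  constructor
  · rintro ⟨v, hv⟩ h
    apply hv
    have := eval_bind₁_genPoly β q f fun i => v i
    rw [h, map_zero] at this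
    rw [this]
    congr 2
    ext j
    rw [genPoint, genPoint]
    congr 1
    exact deviation_congr _ _ _ (fun i hi => by simp [extendZero, hi]) _
  · intro h
    by_contra hn
    refine h (MvPolynomial.funext fun x => ?_)
    rw [eval_bind₁_genPoly, map_zero]
    by_contra hx
    exact hn ⟨_, hx⟩

theorem Hit.mul {L : Type*} [Field L] [Infinite L] {n : ℕ} {β : ℕ → L} {q : ℕ}
    {f g : MvPolynomial (Fin n) L} (hf : Hit β q f) (hg : Hit β q g) : Hit β q (f * g) := by
  rw [hit_iff_bind₁_ne_zero] at *
  rw [map_mul]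
  exact mul_ne_zero hf hg

theorem Hit.of_mul_left {L : Type*} [Field L] {n : ℕ} {β : ℕ → L} {q : ℕ}
    {f g : MvPolynomial (Fin n) L} (h : Hit β q (f * g)) : Hit β q g := by
  obtain ⟨v, hv⟩ := h
  rw [map_mul] at hv
  exact ⟨v, right_ne_zero_of_mul hv⟩

theorem hit_list_prod {L : Type*} [Field L] [Infinite L] {n : ℕ} {β : ℕ → L} {q : ℕ}
    (l : List (MvPolynomial (Fin n) L)) (h : ∀ f ∈ l, Hit β q f) : Hit β q l.prod := by
  induction l with
  | nil => exact ⟨0, by simp⟩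
  | cons f l ih =>
    rw [List.prod_cons]
    exact (h f (by simp)).mul (ih fun g hg => h g (by simp [hg]))

/-- The `r` new pairs are spent on the coordinates where `z` differs from the generated point. -/
theorem exists_genPoint_add {L : Type*} [Field L] [DecidableEq L] {n : ℕ} {β : ℕ → L}
    (hβ : Set.InjOn β (Set.Iio n)) (q r : ℕ) (v : ℕ → L) (z : Fin n → L)
    (hz : hammingDist z (genPoint β n q v) ≤ r) : ∃ w, genPoint β n (q + r) w = z := by
  rw [hammingDist_comm, hammingDist_eq_hammingNorm] at hz
  obtain ⟨w, hw⟩ := exists_deviation_eq hβ r _ hz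
  refine ⟨_, funext fun j => (congrArg (1 + ·) (deviation_append β n q r v w j)).trans ?_⟩
  simp only [hw, Pi.add_apply, Pi.neg_apply, genPoint]
  ring

theorem hit_of_near_one {L : Type*} [Field L] [DecidableEq L] {n : ℕ} {β : ℕ → L}
    (hβ : Set.InjOn β (Set.Iio n)) {q : ℕ} {f : MvPolynomial (Fin n) L} {z : Fin n → L}
    (hz : hammingDist z 1 ≤ q) (hf : eval z f ≠ 0) : Hit β q f := by
  have h1 : genPoint β n 0 0 = 1 := by ext j; simp [genPoint, deviation]
  obtain ⟨w, hw⟩ := exists_genPoint_add hβ 0 q 0 z (by rwa [h1])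
  rw [zero_add] at hw
  exact ⟨w, by rwa [hw]⟩

end Hit

/-! ### Products of sparse blocks: changing single blocks. -/

section WidthTwo

open MvPolynomial

/-- `hk` says that `k` bounds the integers below both `log₂ s` and `μ`. It is used for entries with
`s`, `μ`, and for determinants with `s * s`, `2 * μ`. -/
theorem exists_eval_ne_zero_near_of_subset {L : Type*} [Field L] [Infinite L] [DecidableEq L]
    {n : ℕ} {p : MvPolynomial (Fin n) L} {a : Fin n → L} (ha : ∀ j, a j ≠ 0) (hp : p ≠ 0)
    {E : Finset (Fin n →₀ ℕ)} (hE : p.support ⊆ E) {s μ k : ℕ} (hs : E.card ≤ s)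
    (hμ : ∀ e ∈ E, e.support.card ≤ μ) (hk : ∀ t, 2 ^ t ≤ s → t ≤ μ → t ≤ k) :
    ∃ z : Fin n → L, eval z p ≠ 0 ∧ hammingDist z a ≤ k := by
  obtain ⟨z, hz, hc, e, he, hec⟩ := exists_eval_ne_zero_near p a ha hp
  exact ⟨z, hz, hk _ ((hc.trans (Finset.card_le_card hE)).trans hs) (hec.trans (hμ e (hE he)))⟩

theorem eval_eq_of_agree {L : Type*} [Field L] {n : ℕ} {p : MvPolynomial (Fin n) L}
    {x z : Fin n → L} (h : ∀ e ∈ p.support, ∀ j, e j ≠ 0 → x j = z j) : eval x p = eval z p := by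
  rw [eval_eq', eval_eq']
  refine Finset.sum_congr rfl fun e he => ?_
  congr 1
  refine Finset.prod_congr rfl fun j _ => ?_
  by_cases hj : e j = 0
  · simp [hj]
  · rw [h e he j hj]

/-- `D` is a family of `2 × 2` matrices, the entries of `D i` have their monomials in `E i`,
which has at most `s` elements, each with at most `μ` variables, all in the block `i`. -/
structure SparseBlocks {L ι : Type*} [Field L] {n : ℕ} (blk : Fin n → ι)
    (D : ι → Matrix (Fin 2) (Fin 2) (MvPolynomial (Fin n) L)) (E : ι → Finset (Fin n →₀ ℕ))
    (s μ : ℕ) : Prop where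
  support_subset : ∀ i r c, (D i r c).support ⊆ E i
  card_le : ∀ i, (E i).card ≤ s
  width_le : ∀ i, ∀ e ∈ E i, e.support.card ≤ μ
  block : ∀ i, ∀ e ∈ E i, ∀ j, e j ≠ 0 → blk j = i

theorem eval_list_prod {L ι : Type*} [Field L] {n : ℕ}
    (D : ι → Matrix (Fin 2) (Fin 2) (MvPolynomial (Fin n) L)) (z : Fin n → L) (l : List ι)
    (r c : Fin 2) :
    eval z ((l.map D).prod r c) = (l.map fun i => (D i).map (eval z)).prod r c := by
  have := map_list_prod (RingHom.mapMatrix (m := Fin 2) (eval z)) (l.map D)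
  rw [List.map_map] at this
  exact congrFun (congrFun this r) c

variable {L ι : Type*} [Field L] {n : ℕ} {blk : Fin n → ι}
  {D : ι → Matrix (Fin 2) (Fin 2) (MvPolynomial (Fin n) L)} {E : ι → Finset (Fin n →₀ ℕ)} {s μ : ℕ}

theorem SparseBlocks.map_eval_congr (h : SparseBlocks blk D E s μ) {x z : Fin n → L} {i : ι}
    (hxz : ∀ j, blk j = i → x j = z j) : (D i).map (eval x) = (D i).map (eval z) := by
  ext r c
  exact eval_eq_of_agree fun e he j hj => hxz j (h.block i e (h.support_subset i r c he) j hj)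

theorem SparseBlocks.prod_map_eval_congr (h : SparseBlocks blk D E s μ) {x z : Fin n → L}
    {l : List ι} (hxz : ∀ j, blk j ∈ l → x j = z j) :
    (l.map fun i => (D i).map (eval x)) = l.map fun i => (D i).map (eval z) :=
  List.map_congr_left fun _ hi => h.map_eval_congr fun j hj => hxz j (hj ▸ hi)

/-- As a function of the variables in one block, the product is a sparse polynomial. -/
theorem SparseBlocks.exists_restrict (h : SparseBlocks blk D E s μ) {l : List ι} (hl : l.Nodup)
    {b : ι} (hb : b ∈ l) (r c : Fin 2) (x : Fin n → L) :
    ∃ p : MvPolynomial (Fin n) L, p.support ⊆ E b ∧ ∀ z : Fin n → L,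
      (∀ j, blk j ≠ b → z j = x j) → eval z p = eval z ((l.map D).prod r c) := by
  obtain ⟨l₁, l₂, rfl⟩ := List.append_of_mem hb
  have hb₁ : b ∉ l₁ := fun hm => (List.nodup_append.1 hl).2.2 b hm b (by simp) rfl
  have hb₂ : b ∉ l₂ := (List.nodup_cons.1 (List.nodup_append.1 hl).2.1).1
  -- The blocks on both sides of `b` are frozen at `x`, which leaves a linear combination of the
  -- entries of `D b`; all of these have their monomials in `E b`.
  refine ⟨∑ y, ∑ w, C ((l₁.map fun i => (D i).map (eval x)).prod r y *
    (l₂.map fun i => (D i).map (eval x)).prod w c) * D b y w, ?_, fun z hz => ?_⟩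
  · classical
    refine support_sum.trans (Finset.biUnion_subset.2 fun y _ =>
      support_sum.trans (Finset.biUnion_subset.2 fun w _ => ?_))
    rw [C_mul']
    exact support_smul.trans (h.support_subset b y w)
  · rw [eval_list_prod, List.map_append, List.map_cons, List.prod_append, List.prod_cons,
      h.prod_map_eval_congr (l := l₁) (x := z) (z := x) fun j hj => hz j fun hjb => hb₁ (hjb ▸ hj),
      h.prod_map_eval_congr (l := l₂) (x := z) (z := x) fun j hj => hz j fun hjb => hb₂ (hjb ▸ hj)]
    simp only [Matrix.mul_apply, Fin.sum_univ_two, map_add, map_mul, eval_C, Matrix.map_apply]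
    ring

theorem SparseBlocks.exists_near_block [Infinite L] [DecidableEq L] [DecidableEq ι]
    (h : SparseBlocks blk D E s μ) {l : List ι}
    (hl : l.Nodup) {b : ι} (hb : b ∈ l) {r c : Fin 2} {k : ℕ}
    (hk : ∀ t, 2 ^ t ≤ s → t ≤ μ → t ≤ k) {a x : Fin n → L} (ha : ∀ j, a j ≠ 0)
    (hx : eval x ((l.map D).prod r c) ≠ 0) : ∃ z : Fin n → L, (∀ j, blk j ≠ b → z j = x j) ∧
      (Finset.univ.filter fun j => blk j = b ∧ z j ≠ a j).card ≤ k ∧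
      eval z ((l.map D).prod r c) ≠ 0 := by
  obtain ⟨p, hpE, hp⟩ := h.exists_restrict hl hb r c x
  have hp0 : p ≠ 0 := by
    rintro rfl
    exact hx (by rw [← hp x fun _ _ => rfl, map_zero])
  obtain ⟨z, hz, hd⟩ := exists_eval_ne_zero_near_of_subset ha hp0 hpE (h.card_le b) (h.width_le b) hk
  -- The restricted polynomial sees only block `b`, so all other coordinates can be reset to those
  -- of `x`.
  refine ⟨fun j => if blk j = b then z j else x j, fun j hj => if_neg hj, ?_, ?_⟩
  · refine (Finset.card_le_card fun j hj => ?_).trans hd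
    obtain ⟨h1, h2⟩ := (Finset.mem_filter.1 hj).2
    simp only [h1, if_true] at h2
    exact Finset.mem_filter.2 ⟨Finset.mem_univ _, h2⟩
  · rw [← hp _ fun j hj => if_neg hj]
    rwa [eval_eq_of_agree (z := z) fun e he j hj => if_pos (h.block b e (hpE he) j hj)]

/-- The blocks of `B` are moved towards `a` one after the other, each leaving at most `k` deviating
coordinates; the rest of the point stays as in `x`. -/
theorem SparseBlocks.exists_near_blocks [Infinite L] [DecidableEq L] [DecidableEq ι]
    (h : SparseBlocks blk D E s μ) {l : List ι}
    (hl : l.Nodup) {r c : Fin 2} {k : ℕ} (hk : ∀ t, 2 ^ t ≤ s → t ≤ μ → t ≤ k) {a x : Fin n → L}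
    (ha : ∀ j, a j ≠ 0) (hx : eval x ((l.map D).prod r c) ≠ 0) (B : Finset ι) (hB : ∀ b ∈ B, b ∈ l) :
    ∃ z : Fin n → L, (∀ j, blk j ∉ B → z j = x j) ∧
      (Finset.univ.filter fun j => blk j ∈ B ∧ z j ≠ a j).card ≤ B.card * k ∧
      eval z ((l.map D).prod r c) ≠ 0 := by
  induction B using Finset.induction_on with
  | empty => exact ⟨x, fun _ _ => rfl, by simp, hx⟩
  | insert b B hb ih =>
    obtain ⟨y, hyx, hyc, hy⟩ := ih fun i hi => hB i (Finset.mem_insert_of_mem hi)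
    obtain ⟨z, hzy, hzc, hz⟩ := h.exists_near_block hl (hB b (Finset.mem_insert_self b B)) hk ha hy
    refine ⟨z, fun j hj => ?_, ?_, hz⟩
    · rw [Finset.mem_insert, not_or] at hj
      rw [hzy j hj.1, hyx j hj.2]
    · have hsub : (Finset.univ.filter fun j => blk j ∈ insert b B ∧ z j ≠ a j) ⊆
          (Finset.univ.filter fun j => blk j = b ∧ z j ≠ a j) ∪
            Finset.univ.filter fun j => blk j ∈ B ∧ y j ≠ a j := by
        intro j hj
        simp only [Finset.mem_filter, Finset.mem_univ, true_and, Finset.mem_union,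
          Finset.mem_insert] at hj ⊢
        by_cases hjb : blk j = b
        · exact Or.inl ⟨hjb, hj.2⟩
        · exact Or.inr ⟨hj.1.resolve_left hjb, by rw [← hzy j hjb]; exact hj.2⟩
      refine ((Finset.card_le_card hsub).trans (Finset.card_union_le _ _)).trans ?_
      rw [Finset.card_insert_of_notMem hb, add_mul, one_mul]
      omega

/-- If replacing invertible matrices `A i` by matrices `B i` makes an entry of the product nonzero,
then replacing at most one of them does so: in dimension two a row vector is determined up to a
factor by a nonzero column vector that it annihilates. -/
theorem exists_single_replacement [DecidableEq ι] (A B : ι → Matrix (Fin 2) (Fin 2) L)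
    (v : Fin 2 → L) {b : ι} : ∀ {l : List ι}, l.Nodup → b ∉ l → (∀ i ∈ l, (A i).det ≠ 0) →
    ∀ u : Fin 2 → L, u ⬝ᵥ ((l.map B).prod.mulVec v) ≠ 0 → ∃ i ∈ b :: l,
      u ⬝ᵥ ((l.map (Function.update A i (B i))).prod.mulVec v) ≠ 0 := by
  intro l
  induction l with
  | nil => intro _ _ _ u hu; exact ⟨b, by simp, by simpa using hu⟩
  | cons t l ih =>
    intro hnd hb hA u hu
    by_contra! hall
    rw [List.nodup_cons] at hnd
    rw [List.mem_cons, not_or] at hb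
    have hupd : ∀ i, i ∉ l → l.map (Function.update A i (B i)) = l.map A := fun i hi =>
      List.map_congr_left fun j hj => Function.update_of_ne (ne_of_mem_of_not_mem hj hi) _ _
    have hstep : ∀ (M : Matrix (Fin 2) (Fin 2) L) (P : List (Matrix (Fin 2) (Fin 2) L)),
        u ⬝ᵥ ((M :: P).prod.mulVec v) = (Matrix.vecMul u M) ⬝ᵥ (P.prod.mulVec v) := by
      intro M P
      rw [List.prod_cons, ← Matrix.mulVec_mulVec, Matrix.dotProduct_mulVec]
    -- The index `b` lies outside the list, so updating there means no replacement at all.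
    have h1 : (Matrix.vecMul u (A t)) ⬝ᵥ ((l.map A).prod.mulVec v) = 0 := by
      rw [← hstep, ← hall b (by simp), List.map_cons, hupd b hb.2, Function.update_of_ne (Ne.symm hb.1)]
    have h2 : (Matrix.vecMul u (B t)) ⬝ᵥ ((l.map A).prod.mulVec v) = 0 := by
      rw [← hstep, ← hall t (by simp), List.map_cons, hupd t hnd.1, Function.update_self]
    -- Induction with the row vector `u (A t)`: a replacement in the tail would also be one for the
    -- whole list.
    have h3 : (Matrix.vecMul u (A t)) ⬝ᵥ ((l.map B).prod.mulVec v) = 0 := by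
      by_contra hne
      obtain ⟨i, hi, hne'⟩ := ih hnd.2 hb.2 (fun i hi => hA i (by simp [hi])) _ hne
      have hti : t ≠ i := by
        rintro rfl
        rcases List.mem_cons.1 hi with h | h
        · exact hb.1 h.symm
        · exact hnd.1 h
      apply hne'
      rw [← hstep, ← hall i (by simp only [List.mem_cons] at hi ⊢; tauto), List.map_cons,
        Function.update_of_ne hti]
    rw [List.map_cons, hstep] at hu
    have hv : v ≠ 0 := by rintro rfl; simp at hu
    have hu0 : u ≠ 0 := by rintro rfl; simp at hu
    have hg : (l.map A).prod.mulVec v ≠ 0 := by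
      intro h
      refine hv (Matrix.eq_zero_of_mulVec_eq_zero ?_ h)
      have := map_list_prod (Matrix.detMonoidHom (n := Fin 2) (R := L)) (l.map A)
      simp only [Matrix.coe_detMonoidHom] at this
      rw [this]
      refine List.prod_ne_zero fun h0 => ?_
      simp only [List.map_map, List.mem_map, Function.comp] at h0
      obtain ⟨i, hi, hi0⟩ := h0
      exact hA i (by simp [hi]) hi0
    have hp : Matrix.vecMul u (A t) ≠ 0 := fun h =>
      hu0 (Matrix.eq_zero_of_vecMul_eq_zero (hA t (by simp)) h)
    generalize Matrix.vecMul u (A t) = p at *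
    generalize Matrix.vecMul u (B t) = w at *
    generalize (l.map A).prod.mulVec v = g at *
    generalize (l.map B).prod.mulVec v = h at *
    simp only [dotProduct, Fin.sum_univ_two] at *
    -- `p` and `w` annihilate the same nonzero vector `g`, hence are proportional. As `p ≠ 0` also
    -- annihilates `h`, so does `w`, contradicting `hu`.
    have hdet : p 0 * w 1 = p 1 * w 0 := by
      by_cases hg0 : g 0 = 0
      · have hg1 : g 1 ≠ 0 := fun h1 => hg (by ext i; fin_cases i <;> assumption)
        apply mul_right_cancel₀ hg1
        linear_combination p 0 * h2 - w 0 * h1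
      · apply mul_right_cancel₀ hg0
        linear_combination - p 1 * h2 + w 1 * h1
    apply hu
    by_cases hp0 : p 0 = 0
    · have hp1 : p 1 ≠ 0 := fun h1 => hp (by ext i; fin_cases i <;> assumption)
      apply (mul_eq_zero.1 (_ : p 1 * _ = 0)).resolve_left hp1
      linear_combination w 1 * h3 - h 0 * hdet
    · apply (mul_eq_zero.1 (_ : p 0 * _ = 0)).resolve_left hp0
      linear_combination w 0 * h3 + h 1 * hdet

end WidthTwo

end ROABP

namespace ROABP

/-! ### Hitting width-two products: invertible and singular interior factors. -/

section WidthTwo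

open MvPolynomial

variable {L ι : Type*} [Field L] {n : ℕ} {blk : Fin n → ι}
  {D : ι → Matrix (Fin 2) (Fin 2) (MvPolynomial (Fin n) L)} {E : ι → Finset (Fin n →₀ ℕ)} {s μ : ℕ}

-- A `2 × 2` determinant is a difference of products of two entries, so its monomials lie in the
-- sumset `E i + E i`: at most `s²` of them, with at most `2μ` variables each.
open scoped Pointwise in
theorem SparseBlocks.hit_det [Infinite L] (h : SparseBlocks blk D E s μ) {β : ℕ → L}
    (hβ : Set.InjOn β (Set.Iio n)) {k : ℕ} (hk : ∀ t, 2 ^ t ≤ s * s → t ≤ 2 * μ → t ≤ k) {i : ι}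
    (hi : (D i).det ≠ 0) : Hit β k (D i).det := by
  classical
  have hsub : (D i).det.support ⊆ E i + E i := by
    have hm : ∀ r c r' c', (D i r c * D i r' c').support ⊆ E i + E i := fun r c r' c' =>
      (support_mul _ _).trans
        (Finset.add_subset_add (h.support_subset i r c) (h.support_subset i r' c'))
    rw [Matrix.det_fin_two]
    exact (support_sub _ _ _).trans (Finset.union_subset (hm _ _ _ _) (hm _ _ _ _))
  have hwidth : ∀ e ∈ E i + E i, e.support.card ≤ 2 * μ := by
    intro e he
    obtain ⟨e₁, h₁, e₂, h₂, rfl⟩ := Finset.mem_add.1 he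
    have := (Finset.card_le_card (Finsupp.support_add (g₁ := e₁) (g₂ := e₂))).trans
      (Finset.card_union_le _ _)
    have := h.width_le i e₁ h₁
    have := h.width_le i e₂ h₂
    omega
  obtain ⟨z, hz, hd⟩ := exists_eval_ne_zero_near_of_subset (a := 1) (fun _ => one_ne_zero) hi hsub
    (Finset.card_add_le.trans (Nat.mul_le_mul (h.card_le i) (h.card_le i))) hwidth hk
  exact hit_of_near_one hβ hd hz

/-- The budget is `2k` pairs for a point `a` at which the interior factors are invertible, and `k`
for each of the three blocks that must differ from `a`: both ends and one interior block. -/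
theorem SparseBlocks.hit_of_det_ne_zero [Infinite L] (h : SparseBlocks blk D E s μ) {β : ℕ → L}
    (hβ : Set.InjOn β (Set.Iio n)) {k : ℕ} (hk : ∀ t, 2 ^ t ≤ s → t ≤ μ → t ≤ k)
    (hk' : ∀ t, 2 ^ t ≤ s * s → t ≤ 2 * μ → t ≤ 2 * k) {b₀ b₁ : ι} {l : List ι}
    (hl : (b₀ :: (l ++ [b₁])).Nodup) {r c : Fin 2} (hdet : ∀ i ∈ l, (D i).det ≠ 0)
    (hne : ((b₀ :: (l ++ [b₁])).map D).prod r c ≠ 0) :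
    Hit β (5 * k) (((b₀ :: (l ++ [b₁])).map D).prod r c) := by
  classical
  -- The product of all variables is included to force nonzero coordinates of `a`, as the sparse
  -- argument requires.
  obtain ⟨v, hv⟩ : Hit β (2 * k)
      ((l.map fun i => (D i).det).prod * (List.ofFn fun j : Fin n => X j).prod) := by
    refine (hit_list_prod _ fun f hf => ?_).mul (hit_list_prod _ fun f hf => ?_)
    · obtain ⟨i, hi, rfl⟩ := List.mem_map.1 hf
      exact h.hit_det hβ hk' (hdet i hi)
    · obtain ⟨j, rfl⟩ := (List.mem_ofFn' _ _).1 hf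
      exact ⟨fun _ => 0, by simp [genPoint, deviation_zero]⟩
  set a := genPoint β n (2 * k) v with ha
  rw [map_mul, map_list_prod, map_list_prod] at hv
  have hadet : ∀ i ∈ l, ((D i).map (eval a)).det ≠ 0 := by
    intro i hi h0
    apply left_ne_zero_of_mul hv
    refine List.prod_eq_zero (List.mem_map.2 ⟨_, List.mem_map.2 ⟨i, hi, rfl⟩, ?_⟩)
    rw [← h0]
    exact RingHom.map_det _ _
  have ha0 : ∀ j, a j ≠ 0 := by
    intro j h0
    apply right_ne_zero_of_mul hv
    exact List.prod_eq_zero (List.mem_map.2 ⟨X j, (List.mem_ofFn' _ _).2 ⟨j, rfl⟩, by simpa using h0⟩)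
  obtain ⟨x, hx⟩ : ∃ x, eval x (((b₀ :: (l ++ [b₁])).map D).prod r c) ≠ 0 := by
    by_contra! h0
    exact hne (MvPolynomial.funext fun x => by rw [h0, map_zero])
  have hexp : ∀ z : Fin n → L, eval z (((b₀ :: (l ++ [b₁])).map D).prod r c) =
      ((D b₀).map (eval z)) r ⬝ᵥ ((l.map fun i => (D i).map (eval z)).prod.mulVec
        fun y => ((D b₁).map (eval z)) y c) := by
    intro z
    rw [eval_list_prod, List.map_cons, List.map_append, List.prod_cons, List.prod_append]
    simp only [List.map_cons, List.map_nil, List.prod_cons, List.prod_nil, mul_one]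
    rfl
  have hnd := List.nodup_cons.1 hl
  have hnd' := List.nodup_append.1 hnd.2
  obtain ⟨i, hi, hi0⟩ := exists_single_replacement (fun i => (D i).map (eval a))
    (fun i => (D i).map (eval x)) (fun y => ((D b₁).map (eval x)) y c) (b := b₀) hnd'.1
    (fun hm => hnd.1 (by simp [hm])) hadet _ (by rw [← hexp]; exact hx)
  -- The hybrid point takes `x` on the three exceptional blocks and `a` elsewhere, realizing the
  -- single replacement by a substitution.
  set y : Fin n → L := fun j => if blk j ∈ ({b₀, i, b₁} : Finset ι) then x j else a j with hy
  have hyx : ∀ t ∈ ({b₀, i, b₁} : Finset ι), (D t).map (eval y) = (D t).map (eval x) :=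
    fun t ht => h.map_eval_congr fun j hj => if_pos (hj ▸ ht)
  have hy0 : eval y (((b₀ :: (l ++ [b₁])).map D).prod r c) ≠ 0 := by
    rw [hexp, hyx b₀ (by simp), hyx b₁ (by simp)]
    convert hi0 using 4
    refine List.map_congr_left fun t ht => ?_
    by_cases hti : t = i
    · subst hti
      rw [Function.update_self, hyx t (by simp)]
    · rw [Function.update_of_ne hti]
      refine h.map_eval_congr fun j hj => if_neg ?_
      rw [hj]
      simp only [Finset.mem_insert, Finset.mem_singleton, not_or]
      refine ⟨?_, hti, ?_⟩
      · rintro rfl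
        exact hnd.1 (by simp [ht])
      · rintro rfl
        exact hnd'.2.2 t ht t (by simp) rfl
  obtain ⟨z, hzy, hzc, hz⟩ := h.exists_near_blocks hl hk ha0 hy0 {b₀, i, b₁} (by
    intro b hb
    simp only [Finset.mem_insert, Finset.mem_singleton] at hb
    simp only [List.mem_cons, List.mem_append] at hi ⊢
    rcases hb with rfl | rfl | rfl
    · exact Or.inl rfl
    · tauto
    · simp)
  have hd : hammingDist z a ≤ 3 * k := by
    refine (Finset.card_le_card fun j hj => ?_).trans
      (hzc.trans (Nat.mul_le_mul_right k Finset.card_le_three))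
    have hj' := (Finset.mem_filter.1 hj).2
    refine Finset.mem_filter.2 ⟨Finset.mem_univ _, ?_, hj'⟩
    by_contra hnot
    exact hj' (by rw [hzy j hnot, hy]; exact if_neg hnot)
  obtain ⟨w, hw⟩ := exists_genPoint_add hβ (2 * k) (3 * k) v z hd
  refine ⟨w, ?_⟩
  rw [show 5 * k = 2 * k + 3 * k by ring, hw]
  exact hz

/-- A singular factor splits the product. -/
theorem mul_entry_eq_of_det_eq_zero {R : Type*} [CommRing R] (P M Q : Matrix (Fin 2) (Fin 2) R)
    (hM : M.det = 0) (x y r c : Fin 2) :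
    M x y * (P * M * Q) r c = (P * M) r y * (M * Q) x c := by
  rw [Matrix.det_fin_two] at hM
  have h : ∀ x y u v, M x y * M u v = M u y * M x v := by
    intro x y u v
    fin_cases x <;> fin_cases y <;> fin_cases u <;> fin_cases v <;>
      simp only [Fin.zero_eta, Fin.mk_one, Fin.isValue] <;>
      first | ring | linear_combination hM | linear_combination -hM
  simp only [Matrix.mul_apply, Fin.sum_univ_two]
  linear_combination P r 0 * Q 0 c * h x y 0 0 + P r 0 * Q 1 c * h x y 0 1 +
    P r 1 * Q 0 c * h x y 1 0 + P r 1 * Q 1 c * h x y 1 1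

/-- A singular interior factor becomes an end factor of both shorter products, and end factors need
no invertibility. Both halves use the same number of pairs, because hit polynomials are closed under
multiplication; so the budget does not grow in the induction. -/
theorem SparseBlocks.hit [Infinite L] (h : SparseBlocks blk D E s μ) {β : ℕ → L}
    (hβ : Set.InjOn β (Set.Iio n)) {k : ℕ} (hk : ∀ t, 2 ^ t ≤ s → t ≤ μ → t ≤ k)
    (hk' : ∀ t, 2 ^ t ≤ s * s → t ≤ 2 * μ → t ≤ 2 * k) (m : ℕ) : ∀ {b₀ b₁ : ι} {l : List ι},
    l.length = m → (b₀ :: (l ++ [b₁])).Nodup → ∀ r c : Fin 2,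
    ((b₀ :: (l ++ [b₁])).map D).prod r c ≠ 0 →
    Hit β (5 * k) (((b₀ :: (l ++ [b₁])).map D).prod r c) := by
  induction m using Nat.strong_induction_on with
  | _ m ih =>
    intro b₀ b₁ l hlen hl r c hne
    by_cases hdet : ∀ i ∈ l, (D i).det ≠ 0
    · exact h.hit_of_det_ne_zero hβ hk hk' hl hdet hne
    push Not at hdet
    obtain ⟨i, hi, hi0⟩ := hdet
    obtain ⟨l₁, l₂, rfl⟩ := List.append_of_mem hi
    have hprod : ((b₀ :: (l₁ ++ i :: l₂ ++ [b₁])).map D).prod =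
        ((b₀ :: l₁).map D).prod * D i * ((l₂ ++ [b₁]).map D).prod := by
      simp [mul_assoc]
    have hleft : ((b₀ :: (l₁ ++ [i])).map D).prod = ((b₀ :: l₁).map D).prod * D i := by
      simp [mul_assoc]
    have hright : ((i :: (l₂ ++ [b₁])).map D).prod = D i * ((l₂ ++ [b₁]).map D).prod := by
      simp
    have hex : ∃ x y, D i x y ≠ 0 := by
      by_contra! h0
      apply hne
      rw [hprod, show D i = 0 from Matrix.ext h0]
      simp
    obtain ⟨x, y, hxy⟩ := hex
    have key := mul_entry_eq_of_det_eq_zero ((b₀ :: l₁).map D).prod (D i)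
      ((l₂ ++ [b₁]).map D).prod hi0 x y r c
    rw [← hprod, ← hleft, ← hright] at key
    have hne' := mul_ne_zero hxy hne
    rw [key] at hne'
    simp only [List.length_append, List.length_cons] at hlen
    refine Hit.of_mul_left (f := D i x y) ?_
    rw [key]
    refine (ih l₁.length (by omega) rfl (hl.sublist ?_) _ _ (left_ne_zero_of_mul hne')).mul
      (ih l₂.length (by omega) rfl (hl.sublist ?_) _ _ (right_ne_zero_of_mul hne'))
    · simp
    · refine List.Sublist.cons _ ?_
      rw [List.append_assoc]
      exact (List.sublist_append_right l₁ _)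

/-- Since each variable belongs to one block only, degrees do not accumulate along the product; the
second conjunct carries this through the induction. -/
theorem SparseBlocks.degreeOf_le {δ : ℕ} (h : SparseBlocks blk D E s μ)
    (hδ : ∀ i, ∀ e ∈ E i, ∀ j, e j ≤ δ) (j : Fin n) {l : List ι} (hl : l.Nodup) (r c : Fin 2) :
    degreeOf j ((l.map D).prod r c) ≤ δ ∧ (blk j ∉ l → degreeOf j ((l.map D).prod r c) = 0) := by
  induction l generalizing r c with
  | nil =>
    have : degreeOf j ((1 : Matrix (Fin 2) (Fin 2) (MvPolynomial (Fin n) L)) r c) = 0 := by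
      rw [Matrix.one_apply]
      split_ifs <;> simp
    simp [this]
  | cons i l ih =>
    obtain ⟨hi, hl⟩ := List.nodup_cons.1 hl
    have hD : ∀ r c, degreeOf j (D i r c) ≤ δ ∧ (blk j ≠ i → degreeOf j (D i r c) = 0) := by
      intro r c
      refine ⟨degreeOf_le_iff.2 fun e he => hδ i e (h.support_subset i r c he) j, fun hne => ?_⟩
      refine Nat.le_zero.1 (degreeOf_le_iff.2 fun e he => ?_)
      by_contra h0
      exact hne (h.block i e (h.support_subset i r c he) j (by omega))
    have key : ∀ B, (∀ y, degreeOf j (D i r y) + degreeOf j ((l.map D).prod y c) ≤ B) →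
        degreeOf j (((i :: l).map D).prod r c) ≤ B := by
      intro B hB
      rw [List.map_cons, List.prod_cons, Matrix.mul_apply]
      exact (degreeOf_sum_le _ _ _).trans
        (Finset.sup_le fun y _ => (degreeOf_mul_le _ _ _).trans (hB y))
    constructor
    · refine key _ fun y => ?_
      by_cases hj : blk j = i
      · rw [(ih hl y c).2 (hj ▸ hi), add_zero]
        exact (hD r y).1
      · rw [(hD r y).2 hj, zero_add]
        exact (ih hl y c).1
    · intro hj
      rw [List.mem_cons, not_or] at hj
      refine Nat.le_zero.1 (key _ fun y => ?_)
      rw [(hD r y).2 hj.1, (ih hl y c).2 hj.2]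

end WidthTwo

/-! ### From generic parameters to a finite grid. -/

section Grid

open MvPolynomial

theorem degreeOf_bind₁_le {R σ τ : Type*} [CommSemiring R] [Fintype σ] (g : σ → MvPolynomial τ R)
    (f : MvPolynomial σ R) {δ B : ℕ} (hf : ∀ j, degreeOf j f ≤ δ) (i : τ)
    (hg : ∀ j, degreeOf i (g j) ≤ B) :
    degreeOf i (bind₁ g f) ≤ Fintype.card σ * (δ * B) := by
  rw [bind₁, aeval_def, eval₂_eq']
  refine (degreeOf_sum_le _ _ _).trans (Finset.sup_le fun e he => ?_)
  refine (degreeOf_C_mul_le _ _ _).trans ((degreeOf_prod_le _ _ _).trans ?_)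
  refine (Finset.sum_le_card_nsmul _ _ (δ * B) fun j _ => ?_).trans (by simp)
  exact (degreeOf_pow_le _ _ _).trans (Nat.mul_le_mul (degreeOf_le_iff.1 (hf j) e he) (hg j))

theorem degreeOf_extendZero_X_le {L : Type*} [Field L] {m : ℕ} (i : Fin m) (t : ℕ) :
    degreeOf i (extendZero (X : Fin m → MvPolynomial (Fin m) L) t) ≤ 1 := by
  classical
  unfold extendZero
  split_ifs
  · rw [degreeOf_X]; split_ifs <;> simp
  · simp

/-- A term is a coefficient of degree at most one times `n - 1` linear factors; the bound `1 + (n -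
1)` treats both kinds of parameters alike. -/
theorem degreeOf_genPoly_le {L : Type*} [Field L] (β : ℕ → L) (n q : ℕ) (j : Fin n)
    (i : Fin (2 * q)) : degreeOf i (genPoly β n q j) ≤ n := by
  rw [genPoly, genPoint, deviation]
  refine (degreeOf_add_le _ _ _).trans (max_le (by simp) ?_)
  refine (degreeOf_sum_le _ _ _).trans (Finset.sup_le fun t _ => ?_)
  have hprod : degreeOf i (∏ i' ∈ (Finset.range n).erase j,
      (extendZero (X : Fin (2 * q) → MvPolynomial (Fin (2 * q)) L) (2 * t + 1) - C (β i'))) ≤ n - 1 := by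
    refine (degreeOf_prod_le _ _ _).trans ((Finset.sum_le_card_nsmul _ _ 1 fun i' _ => ?_).trans ?_)
    · refine (degreeOf_sub_le _ _ _).trans (max_le (degreeOf_extendZero_X_le _ _) (by simp))
    · simp
  have := degreeOf_extendZero_X_le (L := L) i (2 * t)
  refine (degreeOf_mul_le _ _ _).trans ?_
  have := j.pos
  omega

/-- A polynomial hit by the generator is nonzero at a generated point with parameters among
the first elements of the enumeration. -/
theorem Hit.exists_index {L : Type*} [Field L] [Infinite L] {n : ℕ} {β : ℕ → L} {q δ : ℕ}
    {f : MvPolynomial (Fin n) L} (hf : Hit β q f) (hδ : ∀ j, degreeOf j f ≤ δ)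
    (hβ : Set.InjOn β (Set.Iio (n * n * δ + 1))) : ∃ g : ℕ → ℕ, (∀ i, g i < n * n * δ + 1) ∧
      eval (genPoint β n q fun i => β (g i)) f ≠ 0 := by
  classical
  by_contra! hno
  -- The composed polynomial has degree at most `n * (δ * n)` in each parameter, one less than the
  -- number of grid values.
  refine hit_iff_bind₁_ne_zero.1 hf (eq_zero_of_eval_zero_at_prod_finset _
    (fun _ => (Finset.range (n * n * δ + 1)).image β) (fun i => ?_) fun x hx => ?_)
  · rw [Finset.card_image_of_injOn (by simpa using hβ), Finset.card_range, Nat.lt_succ_iff]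
    refine (degreeOf_bind₁_le _ _ hδ i fun j => degreeOf_genPoly_le β n q j i).trans (le_of_eq ?_)
    rw [Fintype.card_fin]
    ring
  · rw [eval_bind₁_genPoly]
    simp only [Finset.mem_image, Finset.mem_range] at hx
    choose g hg hgx using hx
    rw [← hno (fun i => if h : i < 2 * q then g ⟨i, h⟩ else 0) fun i => by
      split_ifs
      · exact hg _
      · omega]
    congr 2
    ext j
    rw [genPoint, genPoint]
    congr 1
    exact deviation_congr _ _ _ (fun i hi => by simp [extendZero, hi, hgx]) _

end Grid

/-! ### ROABPs as products of square sparse blocks. -/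

section Translation

open MvPolynomial

variable {F : Type*} [Field F] {n : ℕ}

/-- All factors as square matrices: the row `D₀ᵀ` and the column `D_{d+1}` are padded by zeros. -/
noncomputable def factor (A : ROABP F n 2) :
    Fin (A.d + 1 + 1) → Matrix (Fin 2) (Fin 2) (MvPolynomial (Fin n) F) :=
  Fin.cons (Matrix.of fun r c => if r = 0 then A.first c else 0)
    (Fin.snoc (α := fun _ => Matrix (Fin 2) (Fin 2) (MvPolynomial (Fin n) F)) A.middle
      (Matrix.of fun r c => if c = 0 then A.last r else 0))

/-- The indices of the square factors. -/
def middleIndices (d : ℕ) : List (Fin (d + 1 + 1)) :=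
  (List.finRange d).map fun i => i.castSucc.succ

theorem factor_last (A : ROABP F n 2) : A.factor (Fin.last (A.d + 1)) =
    Matrix.of fun r c => if c = 0 then A.last r else 0 := by
  rw [factor, ← Fin.succ_last, Fin.cons_succ, Fin.snoc_last]

theorem factor_middle (A : ROABP F n 2) (i : Fin A.d) : A.factor i.castSucc.succ = A.middle i := by
  rw [factor, Fin.cons_succ, Fin.snoc_castSucc]

theorem nodup_indices (d : ℕ) :
    ((0 : Fin (d + 1 + 1)) :: (middleIndices d ++ [Fin.last (d + 1)])).Nodup := by
  rw [List.nodup_cons, List.nodup_append, middleIndices]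
  refine ⟨?_, ?_, by simp, ?_⟩
  · simp [Fin.ext_iff]
  · exact (List.nodup_finRange d).map fun i j hij => by simpa using hij
  · intro a ha b hb
    simp only [List.mem_map, List.mem_finRange, true_and, List.mem_singleton] at ha hb
    obtain ⟨i, rfl⟩ := ha
    rw [hb, ← Fin.succ_last, Ne, Fin.succ_inj]
    exact (Fin.castSucc_lt_last i).ne

theorem prod_factor (A : ROABP F n 2) :
    (((0 : Fin (A.d + 1 + 1)) :: (middleIndices A.d ++ [Fin.last (A.d + 1)])).map A.factor).prod 0 0 =
      A.poly := by
  have hmid : (middleIndices A.d).map A.factor = List.ofFn A.middle := by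
    rw [middleIndices, List.map_map, List.ofFn_eq_map]
    exact List.map_congr_left fun i _ => A.factor_middle i
  rw [List.map_cons, List.map_append, hmid, List.prod_cons, List.prod_append]
  simp only [List.map_cons, List.map_nil, List.prod_cons, List.prod_nil, mul_one, factor_last]
  rfl

theorem Bounded.of_support_subset {ι κ : Type*} [Fintype ι] [Fintype κ] {δ s μ : ℕ}
    {D : ι → MvPolynomial (Fin n) F} {D' : κ → MvPolynomial (Fin n) F} (h : Bounded δ s μ D)
    (hs : monomials D' ⊆ monomials D) : Bounded δ s μ D' :=
  ⟨fun e he => h.1 e (hs he), (Finset.card_le_card hs).trans h.2, fun e he => h.3 e (hs he)⟩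

theorem UsesOnly.of_support_subset {ι κ : Type*} [Fintype ι] [Fintype κ] {S : Set (Fin n)}
    {D : ι → MvPolynomial (Fin n) F} {D' : κ → MvPolynomial (Fin n) F} (h : UsesOnly D S)
    (hs : monomials D' ⊆ monomials D) : UsesOnly D' S :=
  fun e he => h e (hs he)

/-- Padding by zeros creates no monomials, so all bounds pass to the square factors. -/
theorem factor_bounded_and_usesOnly (A : ROABP F n 2) {δ s μ : ℕ} (hA : A.FactorsBounded δ s μ)
    (i : Fin (A.d + 1 + 1)) : Bounded δ s μ (entries (A.factor i)) ∧
      UsesOnly (entries (A.factor i)) {j | A.block j = i} := by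
  induction i using Fin.cases with
  | zero =>
    have hs : monomials (entries (A.factor 0)) ⊆ monomials A.first := by
      intro e he
      simp only [monomials, Finset.mem_biUnion, Finset.mem_univ, true_and, entries, factor,
        Fin.cons_zero, Matrix.of_apply] at he ⊢
      obtain ⟨p, hp⟩ := he
      split_ifs at hp
      · exact ⟨_, hp⟩
      · simp at hp
    exact ⟨hA.first.of_support_subset hs, A.first_vars.of_support_subset hs⟩
  | succ i =>
    induction i using Fin.lastCases with
    | last =>
      have hs : monomials (entries (A.factor (Fin.last (A.d + 1)))) ⊆ monomials A.last := by
        intro e he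
        simp only [monomials, Finset.mem_biUnion, Finset.mem_univ, true_and, entries, factor_last,
          Matrix.of_apply] at he ⊢
        obtain ⟨p, hp⟩ := he
        split_ifs at hp
        · exact ⟨_, hp⟩
        · simp at hp
      exact ⟨hA.last.of_support_subset hs, A.last_vars.of_support_subset hs⟩
    | cast i =>
      rw [factor_middle]
      -- The indices `i.castSucc.succ` and `i.succ.castSucc` agree by definition.
      exact ⟨hA.middle i, A.middle_vars i⟩

theorem mem_monomials_entries {w : ℕ} {M : Matrix (Fin w) (Fin w) (MvPolynomial (Fin n) F)}
    {r c : Fin w} {e : Fin n →₀ ℕ} (he : e ∈ (M r c).support) : e ∈ monomials (entries M) :=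
  Finset.mem_biUnion.2 ⟨(r, c), Finset.mem_univ _, he⟩

theorem sparseBlocks_factor {L : Type*} [Field L] (f : F →+* L) (A : ROABP F n 2) {δ s μ : ℕ}
    (hA : A.FactorsBounded δ s μ) :
    SparseBlocks A.block (fun i => (A.factor i).map (MvPolynomial.map f))
      (fun i => monomials (entries (A.factor i))) s μ where
  support_subset _ _ _ _ he := mem_monomials_entries (support_map_subset _ _ he)
  card_le i := (A.factor_bounded_and_usesOnly hA i).1.sparsity_le
  width_le i := (A.factor_bounded_and_usesOnly hA i).1.support_le
  block i := (A.factor_bounded_and_usesOnly hA i).2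

theorem prod_map_factor {L : Type*} [Field L] (f : F →+* L) (A : ROABP F n 2) :
    (((0 : Fin (A.d + 1 + 1)) :: (middleIndices A.d ++ [Fin.last (A.d + 1)])).map
      fun i => (A.factor i).map (MvPolynomial.map f)).prod 0 0 = MvPolynomial.map f A.poly := by
  rw [← A.prod_factor]
  have := map_list_prod (RingHom.mapMatrix (m := Fin 2) (MvPolynomial.map (σ := Fin n) f))
    (((0 : Fin (A.d + 1 + 1)) :: (middleIndices A.d ++ [Fin.last (A.d + 1)])).map A.factor)
  rw [List.map_map] at this
  exact (congrFun (congrFun this 0) 0).symm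

theorem degreeOf_map_poly_le {L : Type*} [Field L] (f : F →+* L) (A : ROABP F n 2) {δ s μ : ℕ}
    (hA : A.FactorsBounded δ s μ) (j : Fin n) : degreeOf j (MvPolynomial.map f A.poly) ≤ δ := by
  rw [← prod_map_factor]
  exact ((sparseBlocks_factor f A hA).degreeOf_le
    (fun i => (A.factor_bounded_and_usesOnly hA i).1.degree_le) j (nodup_indices A.d) 0 0).1

/-- Every nonzero polynomial of the class is nonzero at a generated point with small parameters. -/
theorem exists_aeval_genPoint_ne_zero {K : Type*} [Field K] [Algebra F K] (A : ROABP F n 2)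
    {δ s μ k : ℕ} (hA : A.FactorsBounded δ s μ) (hC : A.poly ≠ 0) {β : ℕ → K}
    (hβ : Set.InjOn β (Set.Iio (n * n * δ + 1))) (hn : n ≤ n * n * δ + 1)
    (hk : ∀ t, 2 ^ t ≤ s → t ≤ μ → t ≤ k) (hk' : ∀ t, 2 ^ t ≤ s * s → t ≤ 2 * μ → t ≤ 2 * k) :
    ∃ g : ℕ → ℕ, (∀ i, g i < n * n * δ + 1) ∧
      aeval (genPoint β n (5 * k) fun i => β (g i)) A.poly ≠ 0 := by
  -- `K` may be finite, whereas the argument needs generic points. The grid consists of images of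
  -- elements of `K`, so the nonzero found over `L` already has coordinates in `K`.
  set L := AlgebraicClosure K
  set f : F →+* L := (algebraMap K L).comp (algebraMap F K)
  have hβL : Set.InjOn (fun i => algebraMap K L (β i)) (Set.Iio (n * n * δ + 1)) :=
    (algebraMap K L).injective.comp_injOn hβ
  have hit := (sparseBlocks_factor f A hA).hit (hβL.mono (Set.Iio_subset_Iio hn)) hk hk' _ rfl
    (nodup_indices A.d) 0 0
    (by rw [prod_map_factor]; exact fun h => hC (map_injective f f.injective (by rw [h, map_zero])))
  rw [prod_map_factor] at hit
  obtain ⟨g, hg, hne⟩ := hit.exists_index (degreeOf_map_poly_le f A hA) hβL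
  refine ⟨g, hg, fun h0 => hne ?_⟩
  rw [eval_map]
  have hpt : (genPoint (fun i => algebraMap K L (β i)) n (5 * k) fun i => algebraMap K L (β (g i))) =
      fun j => algebraMap K L (genPoint β n (5 * k) (fun i => β (g i)) j) := by
    ext j
    rw [genPoint, genPoint, map_add, map_one, map_deviation]
  rw [hpt]
  refine (eval₂_comp_left (algebraMap K L) (algebraMap F K) _ A.poly).symm.trans ?_
  rw [← aeval_def, h0, map_zero]

/-- The polynomial is constant, so a grid with one value per variable is enough. -/
theorem aeval_one_ne_zero_of_degree_zero {K : Type*} [Field K] [Algebra F K] (A : ROABP F n 2)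
    {δ s μ : ℕ} (hA : A.FactorsBounded δ s μ) (hC : A.poly ≠ 0) (h : n = 0 ∨ δ = 0) :
    aeval (fun _ => (1 : K)) A.poly ≠ 0 := by
  intro h0
  refine hC (map_injective (algebraMap F K) (algebraMap F K).injective ?_)
  rw [map_zero]
  refine eq_zero_of_eval_zero_at_prod_finset _ (fun _ => {1}) (fun j => ?_) fun x hx => ?_
  · have := degreeOf_map_poly_le (algebraMap F K) A hA j
    have := j.pos
    rw [Finset.card_singleton]
    omega
  · rw [show x = fun _ => 1 from funext fun j => Finset.mem_singleton.1 (hx j), eval_map,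
      ← aeval_def, h0]

theorem poly_eq_zero_of_sparsity_zero (A : ROABP F n 2) {δ μ : ℕ} (hA : A.FactorsBounded δ 0 μ) :
    A.poly = 0 := by
  have h0 := Finset.card_eq_zero.1 (Nat.le_zero.1 hA.first.sparsity_le)
  have : A.first = 0 := by
    ext1 r
    rw [Pi.zero_apply, ← support_eq_empty, ← Finset.subset_empty, ← h0]
    exact Finset.subset_biUnion_of_mem (fun i => (A.first i).support) (Finset.mem_univ r)
  rw [poly, this, zero_dotProduct]

end Translation
end ROABP

namespace AlgRAM

/-! ### Rules for execution with time bounds. -/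

section Runs

variable {K : Type*} [Field K] {β : ℕ → K}

/-- Started in `σ`, the program halts after at most `B` steps in a configuration with `Q`. -/
def Runs (β : ℕ → K) (P : Prog) (σ : Store K) (B : ℕ) (Q : Store K → Prop) : Prop :=
  ∃ σ' t, Exec β P σ σ' t ∧ t ≤ B ∧ Q σ'

theorem Runs.mono {P : Prog} {σ : Store K} {B B' : ℕ} {Q Q' : Store K → Prop}
    (h : Runs β P σ B Q) (hB : B ≤ B') (hQ : ∀ σ', Q σ' → Q' σ') : Runs β P σ B' Q' := by
  obtain ⟨σ', t, he, ht, hq⟩ := h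
  exact ⟨σ', t, he, ht.trans hB, hQ _ hq⟩

theorem Runs.skip {σ : Store K} {B : ℕ} {Q : Store K → Prop} (hB : 1 ≤ B) (h : Q σ) :
    Runs β .skip σ B Q :=
  ⟨_, _, .skip σ, hB, h⟩

theorem Runs.istore {σ : Store K} {B : ℕ} {Q : Store K → Prop} {a v : IExp}
    (hB : a.time σ.imem + v.time σ.imem + 1 ≤ B)
    (h : Q { σ with imem := Function.update σ.imem (a.val σ.imem) (v.val σ.imem) }) :
    Runs β (.istore a v) σ B Q :=
  ⟨_, _, .istore σ a v, hB, h⟩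

theorem Runs.fstore {σ : Store K} {B : ℕ} {Q : Store K → Prop} {a : IExp} {v : FExp}
    (hB : a.time σ.imem + v.time σ.imem + 1 ≤ B)
    (h : Q { σ with fmem := Function.update σ.fmem (a.val σ.imem) (v.val β σ) }) :
    Runs β (.fstore a v) σ B Q :=
  ⟨_, _, .fstore σ a v, hB, h⟩

theorem Runs.write {σ : Store K} {B : ℕ} {Q : Store K → Prop} {v : FExp}
    (hB : v.time σ.imem + 1 ≤ B) (h : Q { σ with out := σ.out ++ [v.val β σ] }) :
    Runs β (.write v) σ B Q :=
  ⟨_, _, .write σ v, hB, h⟩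

theorem Runs.seq {P P' : Prog} {σ : Store K} {B B' : ℕ} {Q R : Store K → Prop}
    (h : Runs β P σ B Q) (h' : ∀ σ', Q σ' → Runs β P' σ' B' R) :
    Runs β (.seq P P') σ (B + B' + 1) R := by
  obtain ⟨σ', t, he, ht, hq⟩ := h
  obtain ⟨σ'', t', he', ht', hr⟩ := h' σ' hq
  exact ⟨σ'', _, he.seq he', by omega, hr⟩

theorem Runs.ite {c : IExp} {P P' : Prog} {σ : Store K} {B : ℕ} {Q : Store K → Prop}
    (h : c.val σ.imem ≠ 0 → Runs β P σ B Q) (h' : c.val σ.imem = 0 → Runs β P' σ B Q) :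
    Runs β (.ite c P P') σ (c.time σ.imem + B + 1) Q := by
  by_cases hc : c.val σ.imem = 0
  · obtain ⟨σ', t, he, ht, hq⟩ := h' hc
    exact ⟨σ', _, .ite_false hc he, by omega, hq⟩
  · obtain ⟨σ', t, he, ht, hq⟩ := h hc
    exact ⟨σ', _, .ite_true hc he, by omega, hq⟩

theorem Runs.while {c : IExp} {P : Prog} {N B C : ℕ} (Inv : ℕ → Store K → Prop)
    (hc : ∀ i < N, ∀ σ, Inv i σ → c.val σ.imem ≠ 0) (hend : ∀ σ, Inv N σ → c.val σ.imem = 0)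
    (ht : ∀ i ≤ N, ∀ σ, Inv i σ → c.time σ.imem ≤ C)
    (hP : ∀ i < N, ∀ σ, Inv i σ → Runs β P σ B (Inv (i + 1))) {σ : Store K} (h : Inv 0 σ) :
    Runs β (.while c P) σ (N * (B + C + 1) + C + 1) (Inv N) := by
  suffices H : ∀ m i, i + m = N → ∀ σ, Inv i σ →
      Runs β (.while c P) σ (m * (B + C + 1) + C + 1) (Inv N) from H N 0 (zero_add N) σ h
  intro m
  induction m with
  | zero =>
    rintro i rfl σ hσ
    exact ⟨σ, _, .while_false (hend σ hσ), by have := ht _ le_rfl σ hσ; omega, hσ⟩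
  | succ m ih =>
    intro i hi σ hσ
    obtain ⟨σ', t, he, htB, hq⟩ := hP i (by omega) σ hσ
    obtain ⟨σ'', t', he', ht', hr⟩ := ih (i + 1) (by omega) σ' hq
    refine ⟨σ'', _, .while_true (hc i (by omega) σ hσ) he he', ?_, hr⟩
    have := ht i (by omega) σ hσ
    rw [add_mul, one_mul]
    omega

/-- The register with number `k`. -/
def reg (k : ℕ) : IExp := .load (.const k)

/-- Counting loop: register `r` runs through the numbers below the value of register `b`. -/
def forLoop (r b : ℕ) (P : Prog) : Prog :=
  .seq (.istore (.const r) (.const 0)) (.while (.sub (reg b) (reg r))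
    (.seq P (.istore (.const r) (.add (reg r) (.const 1)))))

/-- By `hframe` the invariant does not depend on the counter register, whose value is tracked
separately. -/
theorem Runs.forLoop {r b : ℕ} {P : Prog} {N B : ℕ} (Inv : ℕ → Store K → Prop)
    (hb : ∀ i σ, Inv i σ → σ.imem b = N)
    (hframe : ∀ i σ x, Inv i σ → Inv i { σ with imem := Function.update σ.imem r x })
    (hP : ∀ i < N, ∀ σ, Inv i σ → σ.imem r = i →
      Runs β P σ B fun σ' => Inv (i + 1) σ' ∧ σ'.imem r = i) {σ : Store K} (h : Inv 0 σ) :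
    Runs β (AlgRAM.forLoop r b P) σ (N * (B + 14) + 10) (Inv N) := by
  have hw := fun σ' : Store K => Runs.while (σ := σ') (β := β) (c := .sub (reg b) (reg r))
    (P := .seq P (.istore (.const r) (.add (reg r) (.const 1)))) (N := N) (B := B + 7) (C := 5)
    (fun i σ => Inv i σ ∧ σ.imem r = i)
    (fun i hi σ hσ => by simp [IExp.val, reg, hb i σ hσ.1, hσ.2]; omega)
    (fun σ hσ => by simp [IExp.val, reg, hb N σ hσ.1, hσ.2])
    (fun i hi σ hσ => by simp [IExp.time, reg])
    (fun i hi σ hσ => by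
      refine ((hP i hi σ hσ.1 hσ.2).seq (B' := 6) (R := fun σ => Inv (i + 1) σ ∧ σ.imem r = i + 1)
        fun σ' hσ' => Runs.istore ?_ ⟨?_, ?_⟩).mono (by omega) fun _ h => h
      · simp [IExp.time, reg]
      · exact hframe _ _ _ hσ'.1
      · simp [IExp.val, reg, hσ'.2])
  refine (Runs.seq (Runs.istore (B := 3) (Q := fun σ => Inv 0 σ ∧ σ.imem r = 0) ?_ ⟨?_, ?_⟩)
    fun σ' hσ' => hw σ' hσ').mono ?_ fun _ h => h.1
  · simp [IExp.time]
  · exact hframe _ _ _ h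
  · simp [IExp.val]
  · have : N * (B + 7 + 5 + 1) ≤ N * (B + 14) := Nat.mul_le_mul_left _ (by omega)
    omega

/-- The values of some registers. -/
def Regs (σ : Store K) (l : List (ℕ × ℕ)) : Prop :=
  ∀ p ∈ l, σ.imem p.1 = p.2

end Runs

/-! ### Program for one term of the deviation. -/

section Generator

variable {K : Type*} [Field K] {β : ℕ → K}

/-- Multiplies `fmem 1` by the product of all `β w - β i'` with `i' ≠ j`. -/
def nodeProg : Prog :=
  -- With truncated subtraction, `(a - b) + (b - a)` is nonzero exactly when `a ≠ b`.
  forLoop 13 0 (.ite (.add (.sub (reg 13) (reg 10)) (.sub (reg 10) (reg 13)))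
    (.fstore (.const 1) (.mul (.load (.const 1)) (.sub (.elt (reg 14)) (.elt (reg 13))))) .skip)

/-- Register layout: `0` dimension, `4` base, `7` number of points, `8` number of parameter pairs,
`9` current point, `10` coordinate, `12` term, `14` node index, `16` remaining digits, `17`
coefficient index. Field cell `0` accumulates the coordinate. -/
theorem runs_nodeProg {n M T q N j i w x y : ℕ} {acc : K} {o : List K} {σ : Store K}
    (hσ : Regs σ [(0, n), (4, M), (7, T), (8, q), (9, N), (10, j), (12, i), (14, w), (16, x), (17, y)])
    (h0 : σ.fmem 0 = acc) (h1 : σ.fmem 1 = 1) (ho : σ.out = o) :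
    Runs β nodeProg σ (n * 50 + 10) fun σ' =>
      Regs σ' [(0, n), (4, M), (7, T), (8, q), (9, N), (10, j), (12, i), (14, w), (16, x), (17, y)] ∧
      σ'.fmem 0 = acc ∧ σ'.fmem 1 = ∏ i' ∈ (Finset.range n).erase j, (β w - β i') ∧ σ'.out = o := by
  refine (Runs.forLoop (N := n) (B := 36) (fun m σ' =>
      Regs σ' [(0, n), (4, M), (7, T), (8, q), (9, N), (10, j), (12, i), (14, w), (16, x), (17, y)] ∧
      σ'.fmem 0 = acc ∧ σ'.fmem 1 = ∏ i' ∈ (Finset.range m).erase j, (β w - β i') ∧ σ'.out = o)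
    ?_ ?_ ?_ ?_)
  · intro m σ h
    exact h.1 (0, n) (by simp)
  · intro m σ v h
    simpa [Regs] using h
  · rintro m hm σ ⟨hr, hf0, hf1, hout⟩ h13
    simp only [Regs, List.forall_mem_cons] at hr
    refine (Runs.ite (B := 12) (fun hc => Runs.fstore ?_ ?_) fun hc => Runs.skip (by omega) ?_).mono
      (by simp [IExp.time, reg]) fun _ h => h
    · simp [IExp.time, FExp.time, reg]
    · have hmj : m ≠ j := by
        rintro rfl
        simp [IExp.val, reg, h13, hr] at hc
      rw [Finset.range_add_one, Finset.erase_insert_of_ne hmj, Finset.prod_insert (by simp)]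
      simp [Regs, IExp.val, FExp.val, reg, h13, hr, hf0, hf1, hout, mul_comm]
    · have hmj : m = j := by
        simp [IExp.val, reg, h13, hr] at hc
        omega
      subst hmj
      rw [Finset.range_add_one, Finset.erase_insert (by simp)]
      rw [Finset.erase_eq_of_notMem (by simp)] at hf1
      simp [Regs, h13, hr, hf0, hf1, hout]
  · simp [h0, h1, ho]
    simpa [Regs] using hσ

/-- Adds one term of the deviation to `fmem 0`, consuming two digits of register 11. -/
def termProg : Prog :=
  .seq (.fstore (.const 1) .one) <|
  .seq (.istore (.const 15) (.div (reg 11) (reg 4))) <|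
  .seq (.istore (.const 16) (.div (reg 15) (reg 4))) <|
  -- Remainders are computed from quotients, as the machine only divides.
  .seq (.istore (.const 14) (.sub (reg 15) (.mul (reg 16) (reg 4)))) <|
  .seq (.istore (.const 17) (.sub (reg 11) (.mul (reg 15) (reg 4)))) <|
  .seq nodeProg <|
  .seq (.fstore (.const 0) (.add (.load (.const 0)) (.mul (.elt (reg 17)) (.load (.const 1))))) <|
  .istore (.const 11) (reg 16)

theorem Runs.istore_seq {σ : Store K} {B B' : ℕ} {Q : Store K → Prop} {a v : IExp} {P : Prog}
    (hB : a.time σ.imem + v.time σ.imem + 1 ≤ B)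
    (h : Runs β P { σ with imem := Function.update σ.imem (a.val σ.imem) (v.val σ.imem) } B' Q) :
    Runs β (.seq (.istore a v) P) σ (B + B' + 1) Q :=
  Runs.seq (Runs.istore (Q := fun σ' => σ' = _) hB rfl) fun _ hσ => hσ ▸ h

theorem Runs.fstore_seq {σ : Store K} {B B' : ℕ} {Q : Store K → Prop} {a : IExp} {v : FExp} {P : Prog}
    (hB : a.time σ.imem + v.time σ.imem + 1 ≤ B)
    (h : Runs β P { σ with fmem := Function.update σ.fmem (a.val σ.imem) (v.val β σ) } B' Q) :
    Runs β (.seq (.fstore a v) P) σ (B + B' + 1) Q :=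
  Runs.seq (Runs.fstore (Q := fun σ' => σ' = _) hB rfl) fun _ hσ => hσ ▸ h

/-- Bounding bit lengths by the numbers themselves is crude, but enough for a polynomial time bound.
-/
theorem size_le_of_le {x W : ℕ} (h : x ≤ W) : x.size ≤ W :=
  (Nat.size_le.2 Nat.lt_two_pow_self).trans h

theorem runs_termProg {n M T q N j i x W : ℕ} {acc : K} {o : List K} {σ : Store K}
    (hσ : Regs σ [(0, n), (4, M), (7, T), (8, q), (9, N), (10, j), (12, i), (11, x)])
    (h0 : σ.fmem 0 = acc) (ho : σ.out = o) (hM : M ≤ W) (hx : x ≤ W) :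
    Runs β termProg σ (n * 50 + 8 * W + 100) fun σ' =>
      Regs σ' [(0, n), (4, M), (7, T), (8, q), (9, N), (10, j), (12, i), (11, x / M / M)] ∧
      σ'.fmem 0 = acc + β (x % M) * ∏ i' ∈ (Finset.range n).erase j, (β (x / M % M) - β i') ∧
      σ'.out = o := by
  have hsM := size_le_of_le hM
  have hsx := size_le_of_le hx
  have hsx1 := size_le_of_le ((Nat.div_le_self x M).trans hx)
  have hsx2 := size_le_of_le ((Nat.div_le_self _ M).trans ((Nat.div_le_self x M).trans hx))
  have e1 : x / M - x / M / M * M = x / M % M := by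
    rw [Nat.mod_eq_sub_div_mul]
  have e2 : x - x / M * M = x % M := by
    rw [Nat.mod_eq_sub_div_mul]
  simp only [Regs, List.forall_mem_cons] at hσ
  refine Runs.mono (Q := _) (Runs.fstore_seq (B := 3) ?_ <| Runs.istore_seq (B := 2 * W + 7) ?_ <|
    Runs.istore_seq (B := 2 * W + 7) ?_ <| Runs.istore_seq (B := 2 * W + 10) ?_ <|
    Runs.istore_seq (B := 2 * W + 10) ?_ <|
    Runs.seq (runs_nodeProg (n := n) (M := M) (T := T) (q := q) (N := N) (j := j) (i := i)
      (w := x / M % M) (x := x / M / M) (y := x % M) (acc := acc) (o := o) ?_ ?_ ?_ ?_) fun σ' hσ' =>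
    Runs.fstore_seq (B := 11) ?_ <| Runs.istore (B := 4) ?_ ?_) ?_ fun _ h => h
  · simp [IExp.time, FExp.time]
  · simp [IExp.time, IExp.val, reg, hσ]
    omega
  · simp [IExp.time, IExp.val, reg, hσ]
    omega
  · simp [IExp.time, IExp.val, reg, hσ]
    omega
  · simp [IExp.time, IExp.val, reg, hσ]
    omega
  · simp [Regs, IExp.val, reg, hσ, e1, e2]
  · simpa [IExp.val] using h0
  · simp [IExp.val, FExp.val]
  · exact ho
  · simp [IExp.time, FExp.time, reg]
  · simp [IExp.time, reg]
  · obtain ⟨hr, hf0, hf1, hout⟩ := hσ'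
    simp only [Regs, List.forall_mem_cons] at hr
    simp [Regs, IExp.val, FExp.val, reg, hr, hf0, hf1, hout]
  · omega

end Generator
end AlgRAM

namespace AlgRAM

/-! ### Programs for the enumeration of all points. -/

section Enumeration

variable {K : Type*} [Field K] {β : ℕ → K}

/-- The parameters of the generator encoded by the digits of `N` in base `M`. -/
def digitParam (β : ℕ → K) (M N t : ℕ) : K := β (N / M ^ t % M)

/-- Writes one coordinate of the point with number `N`. -/
def coordProg : Prog :=
  .seq (.fstore (.const 0) .one) <| .seq (.istore (.const 11) (reg 9)) <|
  .seq (forLoop 12 8 termProg) <| .write (.load (.const 0))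

theorem runs_coordProg {n M T q N j W : ℕ} {o : List K} {σ : Store K}
    (hσ : Regs σ [(0, n), (4, M), (7, T), (8, q), (9, N), (10, j)]) (ho : σ.out = o)
    (hM : M ≤ W) (hN : N ≤ W) :
    Runs β coordProg σ (q * (n * 50 + 8 * W + 114) + 24) fun σ' =>
      Regs σ' [(0, n), (4, M), (7, T), (8, q), (9, N), (10, j)] ∧
      σ'.out = o ++ [1 + ROABP.deviation β n q (digitParam β M N) j] := by
  simp only [Regs, List.forall_mem_cons] at hσ
  refine Runs.mono (Runs.fstore_seq (B := 3) ?_ <| Runs.istore_seq (B := 4) ?_ <|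
    Runs.seq (Runs.forLoop (N := q) (B := n * 50 + 8 * W + 100) (fun m σ' =>
      Regs σ' [(0, n), (4, M), (7, T), (8, q), (9, N), (10, j), (11, N / M ^ (2 * m))] ∧
      σ'.fmem 0 = 1 + ROABP.deviation β n m (digitParam β M N) j ∧ σ'.out = o) ?_ ?_ ?_ ?_)
    fun σ' hσ' => Runs.write (B := 3) ?_ ?_) ?_ fun _ h => h
  · simp [IExp.time, FExp.time]
  · simp [IExp.time, reg]
  · intro m σ h
    exact h.1 (8, q) (by simp)
  · intro m σ v h
    simpa [Regs] using h
  · rintro m hm σ ⟨hr, hf, hout⟩ h12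
    simp only [Regs, List.forall_mem_cons] at hr
    refine (runs_termProg (n := n) (M := M) (T := T) (q := q) (N := N) (j := j) (i := m)
      (x := N / M ^ (2 * m)) (W := W) (acc := _) (o := o) (by simp [Regs, hr, h12]) hf hout hM
      ((Nat.div_le_self _ _).trans hN)).mono le_rfl fun σ' hσ' => ?_
    obtain ⟨hr', hf', hout'⟩ := hσ'
    simp only [Regs, List.forall_mem_cons] at hr'
    have e1 : N / M ^ (2 * m) / M = N / M ^ (2 * m + 1) := by
      rw [Nat.div_div_eq_div_mul, pow_succ]
    have e2 : N / M ^ (2 * m) / M / M = N / M ^ (2 * (m + 1)) := by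
      rw [e1, Nat.div_div_eq_div_mul, ← pow_succ, mul_add]
    refine ⟨⟨by simp [Regs, hr', ← e2], ?_, hout'⟩, hr'.2.2.2.2.2.2.1⟩
    rw [hf', e1, ROABP.deviation, ROABP.deviation, Finset.sum_range_succ, add_assoc]
    rfl
  · simp [Regs, IExp.val, FExp.val, reg, hσ, ho, ROABP.deviation]
  · simp [IExp.time, FExp.time]
  · obtain ⟨hr, hf, hout⟩ := hσ'
    simp only [Regs, List.forall_mem_cons] at hr
    simp [Regs, IExp.val, FExp.val, hr, hf, hout]
  · rw [add_assoc (n * 50 + 8 * W) 100 14]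
    omega

/-- Writes all points. -/
def pointsProg : Prog := forLoop 9 7 (forLoop 10 0 coordProg)

theorem ofFn_genPoint (n q : ℕ) (v : ℕ → K) : List.ofFn (ROABP.genPoint β n q v) =
    (List.range n).map fun j => 1 + ROABP.deviation β n q v j := by
  rw [List.ofFn_eq_map, ← List.map_coe_finRange_eq_range, List.map_map]
  rfl

theorem runs_pointsProg {n M T q W : ℕ} {σ : Store K}
    (hσ : Regs σ [(0, n), (4, M), (7, T), (8, q)]) (ho : σ.out = []) (hM : M ≤ W) (hT : T ≤ W) :
    Runs β pointsProg σ (T * (n * (q * (n * 50 + 8 * W + 114) + 38) + 24) + 10) fun σ' =>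
      σ'.out = (((List.range T).map fun N =>
        ROABP.genPoint β n q (digitParam β M N)).map List.ofFn).flatten := by
  refine (Runs.forLoop (N := T) (B := n * (q * (n * 50 + 8 * W + 114) + 38) + 10) (fun N σ' =>
    Regs σ' [(0, n), (4, M), (7, T), (8, q)] ∧ σ'.out = (((List.range N).map fun N =>
        ROABP.genPoint β n q (digitParam β M N)).map List.ofFn).flatten) ?_ ?_ ?_ ?_).mono
    le_rfl fun _ h => h.2
  · intro m σ h
    exact h.1 (7, T) (by simp)
  · intro m σ v h
    simpa [Regs] using h
  · rintro N hN σ ⟨hr, hout⟩ h9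
    simp only [Regs, List.forall_mem_cons] at hr
    refine (Runs.forLoop (N := n) (B := q * (n * 50 + 8 * W + 114) + 24) (fun m σ' =>
      Regs σ' [(0, n), (4, M), (7, T), (8, q), (9, N)] ∧ σ'.out = (((List.range N).map fun N =>
        ROABP.genPoint β n q (digitParam β M N)).map List.ofFn).flatten ++
        (List.range m).map fun j => 1 + ROABP.deviation β n q (digitParam β M N) j)
      ?_ ?_ ?_ ?_).mono le_rfl ?_
    · intro m σ h
      exact h.1 (0, n) (by simp)
    · intro m σ v h
      simpa [Regs] using h
    · rintro j hj σ ⟨hr, hout⟩ h10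
      simp only [Regs, List.forall_mem_cons] at hr
      refine (runs_coordProg (n := n) (M := M) (T := T) (q := q) (N := N) (j := j) (W := W)
        (by simp [Regs, hr, h10]) hout hM (hN.le.trans hT)).mono le_rfl fun σ' hσ' => ?_
      obtain ⟨hr', hout'⟩ := hσ'
      simp only [Regs, List.forall_mem_cons] at hr'
      refine ⟨⟨by simp [Regs, hr'], ?_⟩, hr'.2.2.2.2.2.1⟩
      rw [hout', List.range_succ, List.map_append, List.append_assoc]
      rfl
    · simp [Regs, hr, h9, hout]
    · rintro σ' ⟨hr', hout'⟩
      simp only [Regs, List.forall_mem_cons] at hr'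
      refine ⟨⟨by simp [Regs, hr'], ?_⟩, hr'.2.2.2.2.1⟩
      rw [hout', List.range_succ, List.map_append, List.map_append, List.flatten_append]
      simp [ofFn_genPoint]
  · simp [ho]
    simpa [Regs] using hσ

/-- Computes the base `M = n²δ + 1` in register 4 and `M¹⁰` in register 18. -/
def baseProg : Prog :=
  .seq (.istore (.const 4) (.add (.mul (.mul (reg 0) (reg 0)) (reg 1)) (.const 1))) <|
  .seq (.istore (.const 5) (.add (.add (reg 2) (reg 2)) (.add (reg 2) (reg 2)))) <|
  -- Exponents 2, 4, 5, 10. Each unit of `k` stands for five pairs of parameters, that is, ten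
  -- digits in base `M`.
  .seq (.istore (.const 18) (.mul (reg 4) (reg 4))) <|
  .seq (.istore (.const 18) (.mul (reg 18) (reg 18))) <|
  .seq (.istore (.const 18) (.mul (reg 18) (reg 4))) <|
  .seq (.istore (.const 18) (.mul (reg 18) (reg 18))) <|
  .seq (.istore (.const 6) (.const 1)) <|
  .istore (.const 7) (.const 1)

theorem runs_baseProg {n δ s μ M W : ℕ} (hMdef : M = n * n * δ + 1) (hδ0 : δ ≠ 0) {σ : Store K}
    (hσ : Regs σ [(0, n), (1, δ), (2, s), (3, μ), (8, 0)]) (ho : σ.out = [])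
    (hn : n ≤ W) (hδ : δ ≤ W) (hM : M ^ 10 ≤ W) :
    Runs β baseProg σ (20 * W + 100) fun σ' =>
      Regs σ' [(0, n), (4, M), (5, 4 * s), (18, M ^ 10), (6, 1), (3, μ), (7, 1), (8, 0)] ∧
      σ'.out = [] := by
  have hM1 : 1 ≤ M := by omega
  have hp : ∀ a ≤ 10, (M ^ a).size ≤ W := fun a ha =>
    size_le_of_le ((Nat.pow_le_pow_right hM1 ha).trans hM)
  have h1 := hp 1 (by omega)
  have h2 := hp 2 (by omega)
  have h4 := hp 4 (by omega)
  have h5 := hp 5 (by omega)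
  rw [pow_one] at h1
  have hnn : (n * n).size ≤ W := size_le_of_le <|
    ((Nat.le_mul_of_pos_right (n * n) (Nat.pos_of_ne_zero hδ0)).trans (by omega)).trans
      ((Nat.le_self_pow (by omega) M).trans hM)
  have hsn := size_le_of_le hn
  have hsδ := size_le_of_le hδ
  simp only [Regs, List.forall_mem_cons] at hσ
  have e2 : M * M = M ^ 2 := by ring
  have e4 : M ^ 2 * M ^ 2 = M ^ 4 := by ring
  have e5 : M ^ 4 * M = M ^ 5 := by ring
  have e10 : M ^ 5 * M ^ 5 = M ^ 10 := by ring
  refine Runs.mono (Runs.istore_seq (B := 5 * W + 20) ?_ <| Runs.istore_seq (B := 13) ?_ <|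
    Runs.istore_seq (B := 2 * W + 10) ?_ <| Runs.istore_seq (B := 2 * W + 10) ?_ <|
    Runs.istore_seq (B := 2 * W + 10) ?_ <| Runs.istore_seq (B := 2 * W + 10) ?_ <|
    Runs.istore_seq (B := 3) ?_ <| Runs.istore (B := 3) ?_ ?_) ?_ fun _ h => h
  · simp [IExp.time, IExp.val, reg, hσ]
    omega
  · simp [IExp.time, reg]
  · simp [IExp.time, IExp.val, reg, hσ, ← hMdef]
    omega
  · simp [IExp.time, IExp.val, reg, hσ, ← hMdef, e2]
    omega
  · simp [IExp.time, IExp.val, reg, hσ, ← hMdef, e2, e4]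
    omega
  · simp [IExp.time, IExp.val, reg, hσ, ← hMdef, e2, e4, e5]
    omega
  · simp [IExp.time]
  · simp [IExp.time]
  · simp [Regs, IExp.val, reg, hσ, ← hMdef, e2, e4, e5, e10, ho]
    omega
  · omega

/-- Computes `5 min (⌈log₂ (4s)⌉, μ)` in register 8 and the number of points in register 7. -/
def countProg : Prog :=
  -- As `a - (a - b) = min a b`, the loop runs while both `4s - 2 ^ i` and `μ - i` are positive,
  -- which is the case for exactly `k` passes.
  .while (.sub (.sub (reg 5) (reg 6)) (.sub (.sub (reg 5) (reg 6)) (reg 3))) <|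
  .seq (.istore (.const 6) (.add (reg 6) (reg 6))) <|
  .seq (.istore (.const 3) (.sub (reg 3) (.const 1))) <|
  .seq (.istore (.const 7) (.mul (reg 7) (reg 18))) <|
  .istore (.const 8) (.add (reg 8) (.const 5))

theorem runs_countProg {n s μ M k W : ℕ} (hk : k = min (Nat.clog 2 (4 * s)) μ) {σ : Store K}
    (hσ : Regs σ [(0, n), (4, M), (5, 4 * s), (18, M ^ 10), (6, 1), (3, μ), (7, 1), (8, 0)])
    (ho : σ.out = []) (hM1 : 1 ≤ M) (hM : M ^ 10 ≤ W) (hT : M ^ (2 * (5 * k)) ≤ W) :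
    Runs β countProg σ (k * (2 * W + 60) + 20) fun σ' =>
      Regs σ' [(0, n), (4, M), (7, M ^ (2 * (5 * k))), (8, 5 * k)] ∧ σ'.out = [] := by
  refine Runs.mono (Runs.while (N := k) (B := 2 * W + 40) (C := 15) (fun i σ' =>
    Regs σ' [(0, n), (4, M), (5, 4 * s), (18, M ^ 10), (6, 2 ^ i), (3, μ - i),
      (7, M ^ (2 * (5 * i))), (8, 5 * i)] ∧ σ'.out = []) ?_ ?_ ?_ ?_ ?_) ?_ ?_
  · rintro i hi σ ⟨hr, -⟩
    simp only [Regs, List.forall_mem_cons] at hr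
    have h1 : 2 ^ i < 4 * s := (Nat.lt_clog_iff_pow_lt one_lt_two).1 (by omega)
    simp [IExp.val, reg, hr]
    omega
  · rintro σ ⟨hr, -⟩
    simp only [Regs, List.forall_mem_cons] at hr
    simp only [IExp.val, reg, hr]
    rcases le_total (Nat.clog 2 (4 * s)) μ with h | h
    · have h1 : 4 * s ≤ 2 ^ k := (Nat.clog_le_iff_le_pow one_lt_two).1 (by omega)
      omega
    · omega
  · intro i _ σ _
    simp [IExp.time, reg]
  · rintro i hi σ ⟨hr, hout⟩
    simp only [Regs, List.forall_mem_cons] at hr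
    have h1 : (M ^ (2 * (5 * i))).size ≤ W :=
      size_le_of_le ((Nat.pow_le_pow_right hM1 (by omega)).trans hT)
    have h2 := size_le_of_le hM
    have e : M ^ (2 * (5 * i)) * M ^ 10 = M ^ (2 * (5 * (i + 1))) := by
      rw [← pow_add]
      ring_nf
    refine Runs.mono (Runs.istore_seq (B := 7) ?_ <| Runs.istore_seq (B := 6) ?_ <|
      Runs.istore_seq (B := 2 * W + 7) ?_ <| Runs.istore (B := 6) ?_ ?_) ?_ fun _ h => h
    · simp [IExp.time, reg]
    · simp [IExp.time, reg]
    · simp [IExp.time, IExp.val, reg, hr]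
      omega
    · simp [IExp.time, reg]
    · simp [Regs, IExp.val, reg, hr, hout, e]
      omega
    · omega
  · simp only [Regs, List.forall_mem_cons] at hσ
    simp [Regs, hσ, ho]
  · have : k * (2 * W + 40 + 15 + 1) ≤ k * (2 * W + 60) := Nat.mul_le_mul_left _ (by omega)
    omega
  · rintro σ' ⟨hr, hout⟩
    simp only [Regs, List.forall_mem_cons] at hr
    simp [Regs, hr, hout]

/-- Writes the point all of whose coordinates are one. -/
def onesProg : Prog := forLoop 4 0 (.write .one)

theorem runs_onesProg {n : ℕ} {σ : Store K} (h0 : σ.imem 0 = n) (ho : σ.out = []) :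
    Runs β onesProg σ (n * 16 + 10) fun σ' => σ'.out = List.replicate n 1 := by
  refine (Runs.forLoop (N := n) (B := 2) (fun i σ' => σ'.imem 0 = n ∧ σ'.out = List.replicate i 1)
    (fun i σ h => h.1) (fun i σ v h => by simpa using h) ?_ ?_).mono le_rfl fun _ h => h.2
  · rintro i hi σ ⟨hr, hout⟩ h4
    refine Runs.write (by simp [FExp.time]) ⟨⟨hr, ?_⟩, h4⟩
    simp [hout, FExp.val, List.replicate_succ']
  · simp [h0, ho]

/-- The whole program. -/
def hittingSetProg : Prog :=
  .ite (reg 0) (.ite (reg 1) (.ite (reg 2) (.seq baseProg (.seq countProg pointsProg))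
    onesProg) onesProg) onesProg

/-- The fourth power comes from the nesting: points, coordinates, terms, and for each term the nodes
and bit costs, each at most linear in `W`. -/
theorem runs_hittingSetProg {n δ s μ M k T W : ℕ} (hn : n ≠ 0) (hδ : δ ≠ 0) (hs : s ≠ 0)
    (hM : M = n * n * δ + 1) (hk : k = min (Nat.clog 2 (4 * s)) μ) (hT : T = M ^ (2 * (5 * k)))
    (hnW : n ≤ W) (hδW : δ ≤ W) (hkW : 5 * k ≤ W) (hMW : M ^ 10 ≤ W) (hTW : T ≤ W) :
    Runs β hittingSetProg (init K [n, δ, s, μ]) (1000 * (W + 1) ^ 4) fun σ' =>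
      σ'.out = (((List.range T).map fun N =>
        ROABP.genPoint β n (5 * k) (digitParam β M N)).map List.ofFn).flatten := by
  have hM1 : 1 ≤ M := by omega
  have hMW' : M ≤ W := (Nat.le_self_pow (by omega) M).trans hMW
  subst hT
  refine Runs.mono (Runs.ite (fun _ => Runs.ite (fun _ => Runs.ite (fun _ =>
    Runs.seq (runs_baseProg (s := s) (μ := μ) hM hδ ?_ rfl hnW hδW hMW) fun σ' hσ' =>
    Runs.seq (runs_countProg hk hσ'.1 hσ'.2 hM1 hMW hTW) fun σ'' hσ'' =>
    runs_pointsProg hσ''.1 hσ''.2 hMW' hTW) ?_) ?_) ?_) ?_ fun _ h => h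
  · simp [Regs, init]
  · intro h; exact absurd h hs
  · intro h; exact absurd h hδ
  · intro h; exact absurd h hn
  · simp only [IExp.time, reg]
    have b1 : M ^ (2 * (5 * k)) * (n * (5 * k * (n * 50 + 8 * W + 114) + 38) + 24) ≤
        W * (W * (W * (W * 50 + 8 * W + 114) + 38) + 24) := by gcongr
    have b2 : k * (2 * W + 60) ≤ W * (2 * W + 60) := Nat.mul_le_mul_right _ (by omega)
    nlinarith [b1, b2, Nat.zero_le (W ^ 3), Nat.zero_le (W ^ 2), Nat.zero_le (W ^ 4)]

theorem runs_hittingSetProg_of_zero {n δ s μ : ℕ} (h : n = 0 ∨ δ = 0 ∨ s = 0) :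
    Runs β hittingSetProg (init K [n, δ, s, μ]) (n * 16 + 19) fun σ' =>
      σ'.out = List.replicate n 1 := by
  have ho : Runs β onesProg (init K [n, δ, s, μ]) (n * 16 + 10) fun σ' =>
      σ'.out = List.replicate n 1 := runs_onesProg rfl rfl
  refine Runs.mono (Runs.ite (B := n * 16 + 16) (fun hn => Runs.mono (Runs.ite (B := n * 16 + 13)
    (fun hδ => Runs.mono (Runs.ite (B := n * 16 + 10) (fun hs => ?_) fun _ => ho)
      (by simp only [IExp.time, reg]; omega) fun _ h => h) fun _ => ho.mono (by omega) fun _ h => h)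
      (by simp only [IExp.time, reg]; omega) fun _ h => h) fun _ => ho.mono (by omega) fun _ h => h)
    (by simp only [IExp.time, reg]; omega) fun _ h => h
  simp [IExp.val, reg, init] at hn hδ hs
  omega

end Enumeration
end AlgRAM

/-! ### Digits and numerical bounds. -/

namespace AlgRAM

theorem exists_digits {M r : ℕ} {g : ℕ → ℕ} (hg : ∀ i, g i < M) :
    ∃ N < M ^ r, ∀ i < r, N / M ^ i % M = g i := by
  refine ⟨finFunctionFinEquiv (fun i : Fin r => (⟨g i, hg i⟩ : Fin M)), Fin.is_lt _, fun i hi => ?_⟩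
  have h := congrFun (finFunctionFinEquiv.symm_apply_apply
    (fun i : Fin r => (⟨g i, hg i⟩ : Fin M))) ⟨i, hi⟩
  exact congrArg Fin.val h

theorem genPoint_digitParam {K : Type*} [Field K] (β : ℕ → K) {n q M N : ℕ} {g : ℕ → ℕ}
    (h : ∀ i < 2 * q, N / M ^ i % M = g i) :
    ROABP.genPoint β n q (digitParam β M N) = ROABP.genPoint β n q fun i => β (g i) := by
  ext j
  rw [ROABP.genPoint, ROABP.genPoint]
  congr 1
  exact ROABP.deviation_congr _ _ _ (fun i hi => by rw [digitParam, h i hi]) _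

/-- A common bound for all numbers that occur in the computation. -/
def valueBound (x : ℕ) : ℕ := 2 ^ 20 * (x + 1) ^ 20

theorem valueBound_mono {x y : ℕ} (h : x ≤ y) : valueBound x ≤ valueBound y := by
  unfold valueBound
  gcongr

/-- The polynomial that bounds the running time. -/
noncomputable def timePoly : Polynomial ℕ :=
  Polynomial.C 1000 * (Polynomial.C (2 ^ 20) * (Polynomial.X + 1) ^ 20 + 1) ^ 4

theorem eval_timePoly (x : ℕ) : timePoly.eval x = 1000 * (valueBound x + 1) ^ 4 := by
  simp only [timePoly, valueBound, Polynomial.eval_mul, Polynomial.eval_C, Polynomial.eval_pow,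
    Polynomial.eval_add, Polynomial.eval_X, Polynomial.eval_one]

theorem valueBound_le_eval_timePoly (x : ℕ) : valueBound x ≤ timePoly.eval x := by
  rw [eval_timePoly]
  have h : valueBound x + 1 ≤ (valueBound x + 1) ^ 4 := Nat.le_self_pow (by omega) _
  omega

theorem linear_le_valueBound (x : ℕ) : 20 * x + 20 ≤ valueBound x := by
  have h : x + 1 ≤ (x + 1) ^ 20 := Nat.le_self_pow (by omega) _
  calc 20 * x + 20 = 20 * (x + 1) := by ring
    _ ≤ 2 ^ 20 * (x + 1) ^ 20 := Nat.mul_le_mul (by norm_num) h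

theorem base_le {n δ s : ℕ} (hs : s ≠ 0) (hδ : δ ≠ 0) :
    n * n * δ + 1 ≤ (n * δ * s) ^ 2 + 1 := by
  have h : n * n * δ * 1 ≤ n * n * δ * (δ * s * s) :=
    Nat.mul_le_mul_left _ (Nat.one_le_iff_ne_zero.2 (by positivity))
  calc n * n * δ + 1 ≤ n * n * δ * (δ * s * s) + 1 := by omega
    _ = _ := by ring

theorem base_pow_le {n δ s k : ℕ} (hs : s ≠ 0) (hδ : δ ≠ 0) :
    (n * n * δ + 1) ^ 10 ≤ valueBound ((n * δ * s) ^ (1 + 2 * k)) := by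
  have hX : n * δ * s ≤ (n * δ * s) ^ (1 + 2 * k) := Nat.le_self_pow (by omega) _
  calc (n * n * δ + 1) ^ 10 ≤ ((n * δ * s) ^ 2 + 1) ^ 10 := Nat.pow_le_pow_left (base_le hs hδ) _
    _ ≤ ((n * δ * s + 1) ^ 2) ^ 10 := Nat.pow_le_pow_left (by ring_nf; omega) _
    _ = 1 * (n * δ * s + 1) ^ 20 := by rw [← pow_mul, one_mul]
    _ ≤ valueBound ((n * δ * s) ^ (1 + 2 * k)) := by
      unfold valueBound
      gcongr
      norm_num

/-- Let `X = nδs`. If `X ≥ 2`, the base is at most `X² + 1 ≤ X³`, and `30k ≤ 20(1 + 2k)`. If `X =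
1`, powers of `X` bound nothing, but then `s = 1` gives `k ≤ 2` and the base is `2`; this is the
source of the constant `2 ^ 20`. -/
theorem card_points_le {n δ s μ k : ℕ} (hn : n ≠ 0) (hδ : δ ≠ 0) (hs : s ≠ 0)
    (hk : k = min (Nat.clog 2 (4 * s)) μ) :
    (n * n * δ + 1) ^ (2 * (5 * k)) ≤ valueBound ((n * δ * s) ^ (1 + 2 * k)) := by
  have hX1 : 1 ≤ n * δ * s := Nat.one_le_iff_ne_zero.2 (by positivity)
  rcases hX1.eq_or_lt with h1 | h2
  · have hs1 : s = 1 := Nat.eq_one_of_mul_eq_one_left h1.symm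
    have hnδ : n * δ = 1 := Nat.eq_one_of_mul_eq_one_right h1.symm
    have hδ1 : δ = 1 := Nat.eq_one_of_mul_eq_one_left hnδ
    have hn1 : n = 1 := Nat.eq_one_of_mul_eq_one_right hnδ
    have hk2 : k ≤ 2 := by
      have : Nat.clog 2 (4 * s) ≤ 2 := (Nat.clog_le_iff_le_pow one_lt_two).2 (by omega)
      omega
    calc (n * n * δ + 1) ^ (2 * (5 * k)) ≤ (n * n * δ + 1) ^ 20 :=
          Nat.pow_le_pow_right (by omega) (by omega)
      _ = 2 ^ 20 * 1 := by rw [hn1, hδ1]; norm_num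
      _ ≤ _ := Nat.mul_le_mul_left _ (Nat.one_le_pow _ _ (by omega))
  · have hM : n * n * δ + 1 ≤ (n * δ * s) ^ 3 := by
      refine (base_le hs hδ).trans ?_
      have h4 : 1 ≤ (n * δ * s) ^ 2 := Nat.one_le_pow _ _ (by omega)
      calc (n * δ * s) ^ 2 + 1 ≤ (n * δ * s) ^ 2 * 2 := by omega
        _ ≤ (n * δ * s) ^ 2 * (n * δ * s) := Nat.mul_le_mul_left _ h2
        _ = _ := by ring
    calc (n * n * δ + 1) ^ (2 * (5 * k)) ≤ ((n * δ * s) ^ 3) ^ (2 * (5 * k)) :=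
          Nat.pow_le_pow_left hM _
      _ = (n * δ * s) ^ (30 * k) := by rw [← pow_mul]; congr 1; ring
      _ ≤ (n * δ * s) ^ ((1 + 2 * k) * 20) := Nat.pow_le_pow_right hX1 (by omega)
      _ = ((n * δ * s) ^ (1 + 2 * k)) ^ 20 := pow_mul _ _ _
      _ ≤ ((n * δ * s) ^ (1 + 2 * k) + 1) ^ 20 := Nat.pow_le_pow_left (by omega) _
      _ ≤ _ := Nat.le_mul_of_pos_left _ (by norm_num)

/-- The factor `4` is slack here: `⌈log₂ s⌉` in place of `⌈log₂(4s)⌉` would do. -/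
theorem le_of_two_pow_le {s μ k t : ℕ} (hk : k = min (Nat.clog 2 (4 * s)) μ) (ht : 2 ^ t ≤ s)
    (htμ : t ≤ μ) : t ≤ k := by
  have h : 2 ^ t ≤ 2 ^ Nat.clog 2 (4 * s) :=
    (ht.trans (by omega)).trans (Nat.le_pow_clog one_lt_two (4 * s))
  have := (Nat.pow_le_pow_iff_right one_lt_two).1 h
  omega

theorem le_of_two_pow_le_mul_self {s μ k t : ℕ} (hk : k = min (Nat.clog 2 (4 * s)) μ)
    (ht : 2 ^ t ≤ s * s) (htμ : t ≤ 2 * μ) : t ≤ 2 * k := by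
  have hs : s ≤ 2 ^ Nat.clog 2 (4 * s) :=
    (show s ≤ 4 * s by omega).trans (Nat.le_pow_clog one_lt_two (4 * s))
  have h : 2 ^ t ≤ 2 ^ (2 * Nat.clog 2 (4 * s)) := by
    rw [two_mul, pow_add]
    exact ht.trans (Nat.mul_le_mul hs hs)
  have := (Nat.pow_le_pow_iff_right one_lt_two).1 h
  omega

end AlgRAM

/-! ### Assembly of the theorem. -/

open AlgRAM in
theorem mainTheorem4 :
    ∃ (P : AlgRAM.Prog) (p : Polynomial ℕ),
      ∀ (n δ s μ ℓ : ℕ), ℓ = 1 + 2 * min (Nat.clog 2 (4 * s)) μ →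
        ∀ (F : Type*) (K : Type*) [Field F] [Field K] [Algebra F K] (β : ℕ → K),
          Set.InjOn β (Set.Iio (p.eval ((n * δ * s) ^ ℓ))) →
            ∃ (H : List (Fin n → K)) (t : ℕ),
              AlgRAM.Outputs β P [n, δ, s, μ] H t ∧
              t ≤ p.eval (n + (n * δ * s) ^ ℓ) ∧
              H.length ≤ p.eval ((n * δ * s) ^ ℓ) ∧
              IsHittingSet H (roabpClass F n 2 δ s μ) := by
  refine ⟨hittingSetProg, timePoly, ?_⟩
  intro n δ s μ ℓ hℓ F K _ _ _ β hβ
  by_cases hz : n = 0 ∨ δ = 0 ∨ s = 0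
  · obtain ⟨σ, t, he, ht, hout⟩ := runs_hittingSetProg_of_zero (β := β) (μ := μ) hz
    -- For degenerate parameters the class contains only constants, so one point suffices.
    refine ⟨[fun _ => 1], t, ⟨σ, he, by simp [hout]⟩, ?_, ?_, ?_⟩
    · have := linear_le_valueBound (n + (n * δ * s) ^ ℓ)
      have := valueBound_le_eval_timePoly (n + (n * δ * s) ^ ℓ)
      omega
    · have := linear_le_valueBound ((n * δ * s) ^ ℓ)
      have := valueBound_le_eval_timePoly ((n * δ * s) ^ ℓ)
      rw [List.length_singleton]
      omega
    · rintro _ ⟨A, hA, rfl⟩ hC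
      refine ⟨_, List.mem_singleton_self _, ?_⟩
      by_cases hs : s = 0
      · subst hs
        exact absurd (A.poly_eq_zero_of_sparsity_zero hA) hC
      · exact A.aeval_one_ne_zero_of_degree_zero hA hC (by tauto)
  · push Not at hz
    obtain ⟨hn, hδ, hs⟩ := hz
    obtain ⟨k, hk⟩ : ∃ k, k = min (Nat.clog 2 (4 * s)) μ := ⟨_, rfl⟩
    rw [← hk] at hℓ
    subst hℓ
    set Y := (n * δ * s) ^ (1 + 2 * k) with hY
    have hXY : n * δ * s ≤ Y := Nat.le_self_pow (by omega) _
    have hnY : n ≤ Y := by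
      refine le_trans ?_ hXY
      rw [mul_assoc]
      exact Nat.le_mul_of_pos_right n (by positivity)
    have hδY : δ ≤ Y := by
      refine le_trans ?_ hXY
      rw [mul_comm n, mul_assoc]
      exact Nat.le_mul_of_pos_right δ (by positivity)
    have hsY : s ≤ Y := by
      refine le_trans ?_ hXY
      exact Nat.le_mul_of_pos_left s (by positivity)
    -- Hence `5k ≤ 20s ≤ 20Y`, which `linear_le_valueBound` absorbs.
    have hkY : k ≤ 4 * s := by
      have : Nat.clog 2 (4 * s) ≤ 4 * s :=
        (Nat.clog_le_iff_le_pow one_lt_two).2 Nat.lt_two_pow_self.le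
      omega
    have hlin := linear_le_valueBound Y
    have hM10 : (n * n * δ + 1) ^ 10 ≤ valueBound Y := base_pow_le hs hδ
    have hMY : n * n * δ + 1 ≤ valueBound Y := (Nat.le_self_pow (by omega) _).trans hM10
    have hT : (n * n * δ + 1) ^ (2 * (5 * k)) ≤ valueBound Y := card_points_le hn hδ hs hk
    obtain ⟨σ, t, he, ht, hout⟩ := runs_hittingSetProg (β := β) (μ := μ) (W := valueBound Y)
      hn hδ hs rfl hk rfl (by omega) (by omega) (by omega) hM10 hT
    refine ⟨_, t, ⟨σ, he, hout⟩, ?_, ?_, ?_⟩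
    · rw [eval_timePoly]
      have hmono : valueBound Y ≤ valueBound (n + Y) := valueBound_mono (by omega)
      exact ht.trans (Nat.mul_le_mul_left _ (Nat.pow_le_pow_left (by omega) _))
    · rw [List.length_map, List.length_range]
      exact hT.trans (valueBound_le_eval_timePoly _)
    · rintro _ ⟨A, hA, rfl⟩ hC
      -- The `n` interpolation nodes lie among the grid values, so distinctness of the latter covers
      -- both.
      have hn' : n ≤ n * n * δ + 1 := by
        have : n * 1 ≤ n * (n * δ) :=
          Nat.mul_le_mul_left _ (Nat.one_le_iff_ne_zero.2 (by positivity))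
        rw [← mul_assoc] at this
        omega
      obtain ⟨g, hg, hne⟩ := A.exists_aeval_genPoint_ne_zero hA hC
        (hβ.mono (Set.Iio_subset_Iio (hMY.trans (valueBound_le_eval_timePoly _)))) hn'
        (fun t => le_of_two_pow_le hk) (fun t => le_of_two_pow_le_mul_self hk)
      obtain ⟨N, hN, hdig⟩ := exists_digits (r := 2 * (5 * k)) hg
      refine ⟨_, List.mem_map.2 ⟨N, List.mem_range.2 hN, rfl⟩, ?_⟩
      rwa [genPoint_digitParam β hdig]
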